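/- Let $G$ be a finite simple graph and $S\subseteq V(G)$. An $S$-tree of $G$ is a subgraph $T$ of $G$ that is a tree with $S\subseteq V(T)$. Trees $T_1,\dots,T_r$ are internally edge disjoint $S$-trees if each is an $S$-tree and, for all $i\ne j$, $V(T_i)\cap V(T_j)=S$ and $E(T_i)\cap E(T_j)=\emptyset$. Let $\kappa_G(S)$ be the maximum number of internally edge disjoint $S$-trees in $G$, and for $2\le k\le |V(G)|$ let $\kappa_k(G)=\min\{\kappa_G(S) : S\subseteq V(G),\ |S|=k\}$. For $n\ge 2$ let $HFQ_n$ be the hierarchical folded hypercube: its vertices are the pairs $x=\langle c(x),p(x)\rangle$ of binary strings of length $n$, and two vertices $x,y$ are adjacent if and only if one of the following holds, where $d_H$ is the Hamming distance and $\overline{u}$ is the bitwise complement of $u$: (1) $c(x)=c(y)$ and $d_H(p(x),p(y))=1$; (2) $c(x)=c(y)$ and $p(x)=\overline{p(y)}$; (3) $c(x)\ne c(y)$, $c(x)=p(x)$ and $c(y)=p(y)=\overline{c(x)}$; (4) $c(x)\ne c(y)$, $c(x)\ne p(x)$, $c(x)=p(y)$ and $p(x)=c(y)$. Then for every integer $n\ge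 2$, $\kappa_3(HFQ_n)=n+1$. -/

import Mathlib

namespace SimpleGraph

/-- An `S`-tree of `G`: a subgraph of `G` that is a tree and whose vertex set contains `S`. -/
def IsSTree {V : Type*} (G : SimpleGraph V) (S : Set V) (T : G.Subgraph) : Prop :=
  T.coe.IsTree ∧ S ⊆ T.verts

/-- A family of internally edge disjoint `S`-trees of `G`: any two of them meet in exactly the
vertices of `S` and have no common edge. -/
def InternallyEdgeDisjointSTrees {V ι : Type*} (G : SimpleGraph V) (S : Set V)
    (T : ι → G.Subgraph) : Prop :=
  (∀ i, G.IsSTree S (T i)) ∧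
    ∀ i j, i ≠ j → (T i).verts ∩ (T j).verts = S ∧ Disjoint (T i).edgeSet (T j).edgeSet

/-- The maximum number `κ_G(S)` of internally edge disjoint `S`-trees of `G`, as an element
of `ℕ∞` (a supremum, so that no convention about unbounded sets of naturals enters). -/
noncomputable def treeConnectivity {V : Type*} (G : SimpleGraph V) (S : Set V) : ℕ∞ :=
  ⨆ (r : ℕ) (_ : ∃ T : Fin r → G.Subgraph, G.InternallyEdgeDisjointSTrees S T), (r : ℕ∞)

/-- The generalized `k`-connectivity `κ_k(G)`: the minimum of `κ_G(S)` over all sets `S` of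
exactly `k` vertices (for `2 ≤ k ≤ |V(G)|`). -/
noncomputable def generalizedConnectivity {V : Type*} (G : SimpleGraph V) (k : ℕ) : ℕ∞ :=
  ⨅ (S : Finset V) (_ : S.card = k), G.treeConnectivity (S : Set V)

end SimpleGraph

/-- Binary strings of length `n`. -/
abbrev BinString (n : ℕ) : Type := Fin n → Bool

/-- The bitwise complement of a binary string. -/
def BinString.compl {n : ℕ} (x : BinString n) : BinString n := fun i => !(x i)

theorem BinString.compl_compl {n : ℕ} (x : BinString n) : x.compl.compl = x := by
  funext i
  simp [BinString.compl]

/-- The `n`-dimensional hierarchical folded hypercube `HFQ_n`. A vertex is a pair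
`x = (c(x), p(x))` of binary strings of length `n`: the cluster and the position in the cluster.
The clause `x ≠ y` only matters in the degenerate case `n = 0`, where the empty string is its own
complement; for `n ≥ 1` it follows from each of the four conditions. -/
def hierarchicalFoldedHypercube (n : ℕ) : SimpleGraph (BinString n × BinString n) where
  Adj x y := x ≠ y ∧
    ((x.1 = y.1 ∧ hammingDist x.2 y.2 = 1) ∨
     (x.1 = y.1 ∧ x.2 = y.2.compl) ∨
     (x.1 ≠ y.1 ∧ x.1 = x.2 ∧ y.1 = y.2 ∧ y.2 = x.1.compl) ∨
     (x.1 ≠ y.1 ∧ x.1 ≠ x.2 ∧ x.1 = y.2 ∧ x.2 = y.1))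
  symm := ⟨by
    rintro x y ⟨hne, h⟩
    refine ⟨hne.symm, ?_⟩
    rcases h with ⟨h1, h2⟩ | ⟨h1, h2⟩ | ⟨h1, h2, h3, h4⟩ | ⟨h1, h2, h3, h4⟩
    · exact Or.inl ⟨h1.symm, by rw [hammingDist_comm]; exact h2⟩
    · exact Or.inr (Or.inl ⟨h1.symm, by rw [h2, BinString.compl_compl]⟩)
    · exact Or.inr (Or.inr (Or.inl ⟨h1.symm, h3, h2, by
        rw [h3, h4, BinString.compl_compl, h2]⟩))
    · exact Or.inr (Or.inr (Or.inr ⟨h1.symm, by rw [← h4, ← h3]; exact h2.symm,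
        h4.symm, h3.symm⟩))⟩
  loopless := ⟨fun _ h => h.1 rfl⟩

/-! Upper bound. Every vertex has at most `n + 2` neighbours. Let `S` contain two adjacent vertices
`x`, `y` and a third vertex `z`. If there were `n + 2` trees, each would use exactly one edge at `x`
and one at `y`, and every edge there would be used. The tree containing the edge `xy` would then
have no other edge at `x` or `y`, so it could not reach `z`.

Lower bound, `n ≥ 3`. It suffices to find `n + 1` connected subgraphs that contain `S`, meet only in
`S` and share no edge inside `S`; spanning trees of these do the rest. Each cluster is a folded
hypercube, which is `(n + 1)`-connected (`foldedCube_vertexConnected`), and for `c ≠ d` position `d`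
of cluster `c` is adjacent to position `c` of cluster `d`. A position other than `c` in cluster `c`
is thus an exit to the cluster of that name, and any set of clusters is joined by its own cross
edges (`hub_connected`). Subgraphs that use disjoint sets of outside clusters can only meet inside
the clusters of `S`, so the problem becomes one of choosing exits.

If `S` meets three clusters, fans (from Menger's theorem) lead from each vertex of `S` to the same
`n + 1` exits. If two vertices share a cluster, `n + 1` internally disjoint connections between them
carry distinct exits, and a fan in the other cluster leads to matching ones. If all three lie in one
cluster, the exits are taken in their closed neighbourhoods. A position used as an exit by two of
the vertices must go to the same tree, which is possible when at most `n + 1` positions are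
repeated. This is `card_commonNbrs_le`, which rests on the fact that the only nontrivial relation
among the `n + 1` generators (units and all-ones) is that they sum to zero. When the cluster's own
name `A` and adjacency inside `S` leave too few exits, either the roles in `S` are exchanged or a
path inside `S` serves as one of the trees.

For `n = 2` a finite computation exhibits three subgraphs for every triple. -/

namespace SimpleGraph

/-! ### Trees from connected subgraphs, and the degree bound -/

variable {V : Type*} {G : SimpleGraph V}

/-- A connected subgraph of a finite graph has a spanning tree. -/
theorem Subgraph.Connected.exists_isTree_le_verts_eq {H : G.Subgraph} (h : H.Connected) :
    ∃ T : G.Subgraph, T ≤ H ∧ T.verts = H.verts ∧ T.coe.IsTree := by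
  obtain ⟨T, hle, hT⟩ := h.coe.exists_isTree_le
  refine ⟨⟨H.verts, fun u v => ∃ (hu : u ∈ H.verts) (hv : v ∈ H.verts), T.Adj ⟨u, hu⟩ ⟨v, hv⟩,
    ?_, ?_, ⟨?_⟩⟩, ⟨le_rfl, ?_⟩, rfl, ?_⟩
  · rintro u v ⟨hu, hv, huv⟩
    exact H.adj_sub (hle huv)
  · rintro u v ⟨hu, _⟩
    exact hu
  · rintro u v ⟨hu, hv, huv⟩
    exact ⟨hv, hu, huv.symm⟩
  · rintro u v ⟨hu, hv, huv⟩
    exact hle huv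
  · convert hT using 1
    ext ⟨u, hu⟩ ⟨v, hv⟩
    exact ⟨fun ⟨_, _, h⟩ => h, fun h => ⟨hu, hv, h⟩⟩

/-- Connected subgraphs that meet only in `S`, no two of which share an edge inside `S`, give
internally edge disjoint `S`-trees. -/
theorem exists_internallyEdgeDisjointSTrees {ι : Type*} {S : Set V} (H : ι → G.Subgraph)
    (hconn : ∀ i, (H i).Connected) (hS : ∀ i, S ⊆ (H i).verts)
    (hverts : ∀ i j, i ≠ j → (H i).verts ∩ (H j).verts ⊆ S)
    (hadj : ∀ i j, i ≠ j → ∀ u ∈ S, ∀ v ∈ S, (H i).Adj u v → ¬ (H j).Adj u v) :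
    ∃ T : ι → G.Subgraph, G.InternallyEdgeDisjointSTrees S T := by
  choose T hle hv hT using fun i => (hconn i).exists_isTree_le_verts_eq
  refine ⟨T, fun i => ⟨hT i, (hv i).symm ▸ hS i⟩, fun i j hij => ⟨?_, ?_⟩⟩
  · rw [hv, hv]
    exact (hverts i j hij).antisymm (Set.subset_inter (hS i) (hS j))
  · rw [Set.disjoint_left]
    intro e
    induction e with
    | _ u v =>
      intro hi hj
      have hi' := (hle i).2 hi
      have hj' := (hle j).2 hj
      exact hadj i j hij u (hverts i j hij ⟨hi'.fst_mem, hj'.fst_mem⟩)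
        v (hverts i j hij ⟨hi'.snd_mem, hj'.snd_mem⟩) hi' hj'

theorem Subgraph.Connected.subset_of_adj_closed {H : G.Subgraph} (h : H.Connected) {X : Set V}
    {a : V} (haX : a ∈ X) (ha : a ∈ H.verts) (hX : ∀ u ∈ X, ∀ v, H.Adj u v → v ∈ X) :
    H.verts ⊆ X := by
  intro b hb
  obtain ⟨p⟩ := h.coe.preconnected ⟨a, ha⟩ ⟨b, hb⟩
  have key : ∀ (u v : H.verts), H.coe.Walk u v → u.1 ∈ X → v.1 ∈ X := by
    intro u v p
    induction p with
    | nil => exact id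
    | cons h _ ih => exact fun hu => ih (hX _ hu _ h)
  exact key _ _ p haX

/-- Two adjacent vertices of degree at most `d` bound the number of trees by `d - 1`. -/
theorem lt_of_internallyEdgeDisjointSTrees {S : Set V} {r d : ℕ} {T : Fin r → G.Subgraph}
    (hT : G.InternallyEdgeDisjointSTrees S T) {x y z : V} (hx : x ∈ S) (hy : y ∈ S) (hz : z ∈ S)
    (hxy : G.Adj x y) (hzx : z ≠ x) (hzy : z ≠ y) {Nx Ny : Finset V}
    (hNx : ∀ v, G.Adj x v → v ∈ Nx) (hNy : ∀ v, G.Adj y v → v ∈ Ny)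
    (hdx : Nx.card ≤ d) (hdy : Ny.card ≤ d) : r < d := by
  classical
  obtain ⟨htree, hdisj⟩ := hT
  have hconn : ∀ i, (T i).Connected := fun i => (Subgraph.connected_iff' ).2 (htree i).1.1
  have hedge : ∀ i j u v, (T i).Adj u v → (T j).Adj u v → i = j := by
    intro i j u v hi hj
    by_contra hij
    exact (Set.disjoint_left.1 (hdisj i j hij).2 (show s(u, v) ∈ (T i).edgeSet from hi)) hj
  have hnb : ∀ u ∈ S, ∀ w ∈ S, w ≠ u → ∀ i, ∃ v, (T i).Adj u v := by
    intro u hu w hw hwu i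
    by_contra hno
    push Not at hno
    have := (hconn i).subset_of_adj_closed (X := {u}) rfl ((htree i).2 hu)
      (by rintro _ rfl v hv; exact absurd hv (hno v)) ((htree i).2 hw)
    exact hwu this
  by_contra hr
  push Not at hr
  -- Each of the `r ≥ d` trees has an edge at `u`, and these edges are distinct. As `u` has at most
  -- `d` neighbours, every edge at `u` belongs to some tree, and it is the only edge of that tree at
  -- `u`.
  have huniq : ∀ u ∈ S, ∀ w ∈ S, w ≠ u → ∀ N : Finset V, (∀ v, G.Adj u v → v ∈ N) → N.card ≤ d →
      ∀ v, G.Adj u v → ∃ i, (T i).Adj u v ∧ ∀ v', (T i).Adj u v' → v' = v := by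
    intro u hu w hw hwu N hN hd v hv
    choose f hf using hnb u hu w hw hwu
    have hinj : Function.Injective f := fun i j hij => hedge i j u (f i) (hf i) (hij ▸ hf j)
    have himg : Finset.univ.image f = N := by
      apply Finset.eq_of_subset_of_card_le
      · intro a ha
        obtain ⟨i, _, rfl⟩ := Finset.mem_image.1 ha
        exact hN _ (hf i).adj_sub
      · rw [Finset.card_image_of_injective _ hinj, Finset.card_univ, Fintype.card_fin]
        omega
    have hsurj : ∀ v, G.Adj u v → ∃ i, f i = v := by
      intro v hv
      have := hN v hv
      rw [← himg] at this
      simpa using this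
    obtain ⟨i, rfl⟩ := hsurj v hv
    refine ⟨i, hf i, fun v' hv' => ?_⟩
    obtain ⟨j, rfl⟩ := hsurj v' hv'.adj_sub
    rw [hedge i j u _ hv' (hf j)]
  obtain ⟨i, hi, hi'⟩ := huniq x hx z hz hzx Nx hNx hdx y hxy
  obtain ⟨j, hj, hj'⟩ := huniq y hy z hz hzy Ny hNy hdy x hxy.symm
  obtain rfl := hedge i j x y hi hj.symm
  -- The tree with the edge `xy` has no other edge at either end, so it is confined to `{x, y}`.
  have := (hconn i).subset_of_adj_closed (X := {x, y}) (Or.inl rfl) ((htree i).2 hx)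
    (by
      rintro u (rfl | rfl) v hv
      · exact Or.inr (hi' v hv)
      · exact Or.inl (hj' v hv)) ((htree i).2 hz)
  rcases this with h | h
  · exact hzx h
  · exact hzy h

end SimpleGraph

/-! ### Menger's theorem for directed walks between sets -/

section Menger

variable {V : Type*}

/-- `ReachIn E A X v`: some walk along the arcs `E` leads from `A` to `v` inside `X`. -/
inductive ReachIn (E : V → V → Prop) (A X : Set V) : V → Prop
  | base {a : V} : a ∈ A → a ∈ X → ReachIn E A X a
  | step {u v : V} : ReachIn E A X u → E u v → v ∈ X → ReachIn E A X v

namespace ReachIn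

variable {E E' : V → V → Prop} {A B X Y : Set V} {u v s : V}

theorem mem (h : ReachIn E A X v) : v ∈ X := by cases h <;> assumption

theorem mono (h : ReachIn E A X v) (hE : ∀ u v, E u v → E' u v) (hXY : X ⊆ Y) :
    ReachIn E' A Y v := by
  induction h with
  | base ha hX => exact .base ha (hXY hX)
  | step _ he hX ih => exact .step ih (hE _ _ he) (hXY hX)

theorem self (h : ReachIn E A X v) : ReachIn E A {w | ReachIn E A X w} v := by
  induction h with
  | base ha hX => exact .base ha (ReachIn.base ha hX)
  | step hu he hX ih => exact .step ih he (ReachIn.step hu he hX)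

/-- The part of a walk up to its first visit of `s`. -/
theorem first_visit (h : ReachIn E A X v) (s : V) :
    ReachIn E A (insert s {w | ReachIn E A (X \ {s}) w}) s ∨ ReachIn E A (X \ {s}) v := by
  induction h with
  | @base a ha hX =>
    rcases eq_or_ne a s with rfl | hne
    · exact .inl (.base ha (.inl rfl))
    · exact .inr (.base ha ⟨hX, hne⟩)
  | @step u v hu he hX ih =>
    rcases ih with ih | ih
    · exact .inl ih
    · rcases eq_or_ne v s with rfl | hne
      · exact .inl (.step (ih.self.mono (fun _ _ => id) (Set.subset_insert _ _)) he (.inl rfl))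
      · exact .inr (.step ih he ⟨hX, hne⟩)

theorem trim (h : ReachIn E A X s) :
    ReachIn E A (insert s {w | ReachIn E A (X \ {s}) w}) s :=
  (h.first_visit s).elim id fun h => absurd rfl h.mem.2

/-- Menger's proof builds one family of walks forwards from `A` and another backwards from `B`; this
glues two of them at a common vertex. -/
theorem append_reverse (hA : ReachIn E A X v) (hB : ReachIn (fun u v => E v u) B Y v) :
    ∃ b ∈ B, ReachIn E A (X ∪ Y) b := by
  have key : ∀ w, ReachIn (fun u v => E v u) B Y w → ReachIn E A (X ∪ Y) w →
      ∃ b ∈ B, ReachIn E A (X ∪ Y) b := by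
    intro w hw
    induction hw with
    | base hb _ => exact fun h => ⟨_, hb, h⟩
    | step hu he _ ih => exact fun h => ih (.step h he (.inr hu.mem))
  exact key v hB (hA.mono (fun _ _ => id) Set.subset_union_left)

theorem of_reverse (hA : ReachIn (fun u v => E v u) B X v) (hv : v ∈ A) :
    ∃ b ∈ B, ReachIn E A X b := by
  obtain ⟨b, hb, h⟩ := append_reverse (.base hv hA.mem) hA
  exact ⟨b, hb, h.mono (fun _ _ => id) (by simp)⟩

end ReachIn

/-- `T` meets every walk from `A` to `B`. -/
def Separates (E : V → V → Prop) (A B T : Set V) : Prop := ∀ b ∈ B, ¬ ReachIn E A Tᶜ b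

theorem Separates.reverse {E : V → V → Prop} {A B T : Set V} (h : Separates E A B T) :
    Separates (fun u v => E v u) B A T := fun a ha hr => by
  obtain ⟨b, hb, h'⟩ := hr.of_reverse ha
  exact h b hb h'

/-- `k` disjoint sets, each of which contains a walk from `A` to `B`. -/
def Linked (E : V → V → Prop) (A B : Set V) (k : ℕ) : Prop :=
  ∃ P : Fin k → Set V, Pairwise (fun i j => Disjoint (P i) (P j)) ∧
    ∀ i, ∃ b ∈ B, ReachIn E A (P i) b

/-- Disjoint walks that end in a set of `k` vertices can be trimmed to end at its vertices,
one at each. -/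
theorem Linked.exists_index {E : V → V → Prop} {A : Set V} [DecidableEq V] {S : Finset V}
    {k : ℕ} (hS : S.card = k) (h : Linked E A S k) :
    ∃ P : V → Set V, (∀ s ∈ S, ∀ t ∈ S, s ≠ t → Disjoint (P s) (P t)) ∧
      (∀ s ∈ S, ReachIn E A (P s) s) ∧
      ∀ s ∈ S, ∀ v ∈ P s, v = s ∨ ReachIn E A (S : Set V)ᶜ v := by
  obtain ⟨P, hP, hr⟩ := h
  choose f hfS hf using hr
  -- Disjoint walks have different ends, and there are as many walks as vertices in `S`, so each
  -- vertex of `S` is the end of exactly one.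
  have hinj : Function.Injective f := fun i j hij => by
    by_contra hne
    exact Set.disjoint_left.1 (hP hne) (hf i).mem (hij ▸ (hf j).mem)
  have himg : Finset.univ.image f = S := by
    apply Finset.eq_of_subset_of_card_le
    · intro a ha
      obtain ⟨i, _, rfl⟩ := Finset.mem_image.1 ha
      exact hfS i
    · rw [Finset.card_image_of_injective _ hinj, Finset.card_univ, Fintype.card_fin, hS]
  have hsurj : ∀ s ∈ S, ∃ i, f i = s := fun s hs => by
    rw [← himg] at hs
    simpa using hs
  have hsurj' : ∀ s, ∃ Q : Set V, s ∈ S → ∃ i, f i = s ∧ Q = P i := fun s => by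
    by_cases hs : s ∈ S
    · obtain ⟨i, hi⟩ := hsurj s hs
      exact ⟨P i, fun _ => ⟨i, hi, rfl⟩⟩
    · exact ⟨∅, fun h => absurd h hs⟩
  choose Q hQ using hsurj'
  refine ⟨fun s => insert s {w | ReachIn E A (Q s \ {s}) w}, ?_, ?_, ?_⟩
  · intro s hs t ht hst
    obtain ⟨i, rfl, hi⟩ := hQ s hs
    obtain ⟨j, rfl, hj⟩ := hQ t ht
    have hij : i ≠ j := fun h => hst (h ▸ rfl)
    refine (hP hij).mono ?_ ?_
    · rintro v (rfl | hv)
      · exact (hf i).mem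
      · exact hi ▸ hv.mem.1
    · rintro v (rfl | hv)
      · exact (hf j).mem
      · exact hj ▸ hv.mem.1
  · intro s hs
    obtain ⟨i, rfl, hi⟩ := hQ s hs
    simpa only [hi] using (hf i).trim
  · rintro s hs v (rfl | hv)
    · exact .inl rfl
    -- Any other vertex of `S` is the end of another walk, hence not in this set.
    · refine .inr (hv.mono (fun _ _ => id) ?_)
      rintro w ⟨hw, hws⟩ hwS
      obtain ⟨i, rfl, hi⟩ := hQ s hs
      obtain ⟨j, rfl⟩ := hsurj w hwS
      rcases eq_or_ne i j with rfl | hij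
      · exact hws rfl
      · rw [hi] at hw
        exact Set.disjoint_left.1 (hP hij) hw (hf j).mem

/-- Menger's theorem for a finite set of arcs. -/
theorem menger [DecidableEq V] [Finite V] (E : Finset (V × V)) (A B : Set V) (k : ℕ)
    (h : ∀ T : Finset V, Separates (fun u v => (u, v) ∈ E) A B T → k ≤ T.card) :
    Linked (fun u v => (u, v) ∈ E) A B k := by
  classical
  have := Fintype.ofFinite V
  generalize hm : E.card = m
  induction m generalizing E A B k with
  | zero =>
    obtain rfl := Finset.card_eq_zero.1 hm
    -- Without arcs all walks are single vertices, so `A ∩ B` is a separator and `k` of its vertices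
    -- are the walks.
    have hk := h (Finset.univ.filter fun v => v ∈ A ∧ v ∈ B) (by
      intro b hb hr
      cases hr with
      | base ha hX => exact hX (by simp [ha, hb])
      | step _ he _ => simp at he)
    obtain ⟨U, hU, hUk⟩ := Finset.exists_subset_card_eq hk
    let e := (Finset.equivFinOfCardEq hUk).symm
    refine ⟨fun i => {(e i : V)}, fun i j hij => ?_, fun i => ⟨e i, ?_, .base ?_ rfl⟩⟩
    · simpa [Subtype.ext_iff] using fun h => hij (e.injective (Subtype.ext h))
    · have := hU (e i).2
      simp only [Finset.mem_filter] at this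
      exact this.2.2
    · have := hU (e i).2
      simp only [Finset.mem_filter] at this
      exact this.2.1
  | succ m ih =>
    obtain ⟨⟨x, y⟩, hxy⟩ := Finset.card_pos.1 (by omega : 0 < E.card)
    set E' := E.erase (x, y) with hE'
    have hcard : E'.card = m := by rw [hE', Finset.card_erase_of_mem hxy]; omega
    have hsub : ∀ u v, (u, v) ∈ E' → (u, v) ∈ E := fun u v h => Finset.mem_of_mem_erase h
    have hcase : ∀ u v, (u, v) ∈ E → (u, v) ∈ E' ∨ (u = x ∧ v = y) := fun u v h => by
      by_cases huv : (u, v) = (x, y)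
      · exact .inr (by simpa using huv)
      · exact .inl (Finset.mem_erase.2 ⟨huv, h⟩)
    by_cases hall : ∀ T : Finset V, Separates (fun u v => (u, v) ∈ E') A B T → k ≤ T.card
    · obtain ⟨P, hP, hr⟩ := ih E' A B k hall hcard
      exact ⟨P, hP, fun i => (hr i).imp fun b hb => ⟨hb.1, hb.2.mono hsub subset_rfl⟩⟩
    push Not at hall
    -- `S` separates only after the deletion of `(x, y)`. Adding `x` or `y` restores a separator for
    -- `E`, so both extended sets have exactly `k` elements.
    obtain ⟨S, hS, hSk⟩ := hall
    -- a walk that avoids `S` uses the arc `(x, y)`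
    have hx : Separates (fun u v => (u, v) ∈ E) A B (insert x S : Finset V) := by
      intro b hb hr
      have key : ReachIn (fun u v => (u, v) ∈ E') A (S : Set V)ᶜ b := by
        clear hb
        induction hr with
        | base ha hX => exact .base ha fun h => hX (by simpa using Or.inr h)
        | @step u v hu he hX ih' =>
          refine .step ih' ((hcase _ _ he).resolve_right ?_) fun h => hX (by simpa using Or.inr h)
          rintro ⟨rfl, _⟩
          exact hu.mem (by simp)
      exact hS b hb key
    have hy : Separates (fun u v => (u, v) ∈ E) A B (insert y S : Finset V) := by
      intro b hb hr
      have key : ReachIn (fun u v => (u, v) ∈ E') A (S : Set V)ᶜ b := by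
        clear hb
        induction hr with
        | base ha hX => exact .base ha fun h => hX (by simpa using Or.inr h)
        | @step u v hu he hX ih' =>
          refine .step ih' ((hcase _ _ he).resolve_right ?_) fun h => hX (by simpa using Or.inr h)
          rintro ⟨_, rfl⟩
          exact hX (by simp)
      exact hS b hb key
    have hxk := h _ hx
    have hyk := h _ hy
    have hxS : x ∉ S := fun h => by rw [Finset.insert_eq_of_mem h] at hxk; omega
    have hyS : y ∉ S := fun h => by rw [Finset.insert_eq_of_mem h] at hyk; omega
    have hxc : (insert x S).card = k := by rw [Finset.card_insert_of_notMem hxS] at hxk ⊢; omega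
    have hyc : (insert y S).card = k := by rw [Finset.card_insert_of_notMem hyS] at hyk ⊢; omega
    -- a separator of `A` from `S ∪ {x}` separates `A` from `B`
    have hleft : ∀ T : Finset V,
        Separates (fun u v => (u, v) ∈ E') A (insert x S : Finset V) T → k ≤ T.card := by
      intro T hT
      refine h T fun b hb hr => ?_
      have key : ReachIn (fun u v => (u, v) ∈ E') A ((T : Set V)ᶜ ∩ (S : Set V)ᶜ) b := by
        clear hb
        induction hr with
        | @base a ha hX =>
          exact .base ha ⟨hX, fun h => hT a (by simpa using Or.inr h) (.base ha hX)⟩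
        | @step u v hu he hX ih' =>
          have hr' := ih'.mono (fun _ _ => id) Set.inter_subset_left
          have he' := (hcase _ _ he).resolve_right (by
            rintro ⟨rfl, _⟩
            exact hT u (by simp) hr')
          exact .step ih' he' ⟨hX, fun h => hT v (by simpa using Or.inr h) (.step hr' he' hX)⟩
      exact hS b hb (key.mono (fun _ _ => id) Set.inter_subset_right)
    have hright : ∀ T : Finset V,
        Separates (fun u v => (v, u) ∈ E') B (insert y S : Finset V) T → k ≤ T.card := by
      intro T hT
      refine h T (Separates.reverse (E := fun u v => (v, u) ∈ E) fun b hb hr => ?_)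
      have key : ReachIn (fun u v => (v, u) ∈ E') B ((T : Set V)ᶜ ∩ (S : Set V)ᶜ) b := by
        clear hb
        induction hr with
        | @base a ha hX =>
          exact .base ha ⟨hX, fun h => hT a (by simpa using Or.inr h) (.base ha hX)⟩
        | @step u v hu he hX ih' =>
          have hr' := ih'.mono (fun _ _ => id) Set.inter_subset_left
          have he' := (hcase _ _ he).resolve_right (by
            rintro ⟨_, rfl⟩
            exact hT u (by simp) hr')
          exact .step ih' he' ⟨hX, fun h => hT v (by simpa using Or.inr h) (.step hr' he' hX)⟩
      exact hS.reverse b hb (key.mono (fun _ _ => id) Set.inter_subset_right)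
    -- By induction there are disjoint walks without the arc `(x, y)`: `P` from `A` to `S ∪ {x}`,
    -- and `Q`, traced backwards, from `B` to `S ∪ {y}`.
    obtain ⟨P, hPd, hPr, hPm⟩ := (ih E' A _ k hleft hcard).exists_index hxc
    obtain ⟨Q, hQd, hQr, hQm⟩ : ∃ Q : V → Set V,
        (∀ s ∈ insert y S, ∀ t ∈ insert y S, s ≠ t → Disjoint (Q s) (Q t)) ∧
        (∀ s ∈ insert y S, ReachIn (fun u v => (v, u) ∈ E') B (Q s) s) ∧
        ∀ s ∈ insert y S, ∀ v ∈ Q s,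
          v = s ∨ ReachIn (fun u v => (v, u) ∈ E') B ((insert y S : Finset V) : Set V)ᶜ v := by
      have := ih (E'.map (Equiv.prodComm V V).toEmbedding) B (insert y S : Finset V) k
        (fun T hT => hright T (by simpa [Separates] using hT)) (by simpa using hcard)
      simpa using this.exists_index hyc
    -- A vertex reached from both sides outside `S` would complete a walk from `A` to `B` avoiding
    -- `S`. Hence `P` and `Q` meet only in `S`.
    have hmeet : ∀ v, ReachIn (fun u v => (u, v) ∈ E') A (S : Set V)ᶜ v →
        ReachIn (fun u v => (v, u) ∈ E') B (S : Set V)ᶜ v → False := by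
      intro v h1 h2
      obtain ⟨b, hb, h3⟩ := h1.append_reverse (E := fun u v => (u, v) ∈ E') h2
      exact hS b hb (h3.mono (fun _ _ => id) (by simp))
    have hPS : ∀ s ∈ insert x S, ∀ v ∈ P s, v ∉ S →
        ReachIn (fun u v => (u, v) ∈ E') A (S : Set V)ᶜ v := by
      intro s hs v hv hvS
      rcases hPm s hs v hv with rfl | h
      · refine (hPr v hs).mono (fun _ _ => id) fun w hw hwS => ?_
        rcases hPm v hs w hw with rfl | h
        · exact hvS hwS
        · exact h.mem (by simpa using Or.inr hwS)
      · exact h.mono (fun _ _ => id) (Set.compl_subset_compl.2 (by simp))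
    have hQS : ∀ s ∈ insert y S, ∀ v ∈ Q s, v ∉ S →
        ReachIn (fun u v => (v, u) ∈ E') B (S : Set V)ᶜ v := by
      intro s hs v hv hvS
      rcases hQm s hs v hv with rfl | h
      · refine (hQr v hs).mono (fun _ _ => id) fun w hw hwS => ?_
        rcases hQm v hs w hw with rfl | h
        · exact hvS hwS
        · exact h.mem (by simpa using Or.inr hwS)
      · exact h.mono (fun _ _ => id) (Set.compl_subset_compl.2 (by simp))
    -- The walk of `P` ending at `x` continues through the arc `(x, y)`; every other one continues
    -- at its own end.
    let σ : V → V := fun s => if s = x then y else s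
    have hσ : ∀ s ∈ insert x S, σ s ∈ insert y S := by
      intro s hs
      by_cases hsx : s = x
      · simp [σ, hsx]
      · simpa [σ, hsx] using Or.inr (Finset.mem_of_mem_insert_of_ne hs hsx)
    have hσS : ∀ s ∈ insert x S, σ s ∈ S → σ s = s := by
      intro s _ h
      by_cases hsx : s = x
      · simp only [σ, hsx, if_true] at h
        exact absurd h hyS
      · simp [σ, hsx]
    have hσinj : ∀ s ∈ insert x S, ∀ t ∈ insert x S, σ s = σ t → s = t := by
      intro s hs t ht hst
      by_cases hsx : s = x <;> by_cases htx : t = x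
      · rw [hsx, htx]
      · have := Finset.mem_of_mem_insert_of_ne ht htx
        simp only [σ, hsx, htx, if_true, if_false] at hst
        exact absurd (hst ▸ this) hyS
      · have := Finset.mem_of_mem_insert_of_ne hs hsx
        simp only [σ, hsx, htx, if_true, if_false] at hst
        exact absurd (hst ▸ this) hyS
      · simpa [σ, hsx, htx] using hst
    have hPQ : ∀ s ∈ insert x S, ∀ t ∈ insert x S, s ≠ t → Disjoint (P s) (Q (σ t)) := by
      intro s hs t ht hst
      refine Set.disjoint_left.2 fun v hvP hvQ => ?_
      by_cases hvS : v ∈ S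
      · have h1 : v = s := (hPm s hs v hvP).resolve_right fun h =>
          h.mem (by simpa using Or.inr hvS)
        have h2 : v = σ t := (hQm _ (hσ t ht) v hvQ).resolve_right fun h =>
          h.mem (by simpa using Or.inr hvS)
        have h3 := hσS t ht (h2 ▸ hvS)
        exact hst (by rw [← h1, h2, h3])
      · exact hmeet v (hPS s hs v hvP hvS) (hQS _ (hσ t ht) v hvQ hvS)
    let e := (Finset.equivFinOfCardEq hxc).symm
    refine ⟨fun i => P (e i) ∪ Q (σ (e i)), fun i j hij => ?_, fun i => ?_⟩
    · have hne : (e i : V) ≠ e j := fun h => hij (e.injective (Subtype.ext h))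
      have hi := (e i).2
      have hj := (e j).2
      simp only [Set.disjoint_union_left, Set.disjoint_union_right]
      exact ⟨⟨hPd _ hi _ hj hne, (hPQ _ hj _ hi hne.symm).symm⟩, hPQ _ hi _ hj hne,
        hQd _ (hσ _ hi) _ (hσ _ hj) fun h => hne (hσinj _ hi _ hj h)⟩
    · have hi := (e i).2
      have hP := hPr _ hi
      have hQ := hQr _ (hσ _ hi)
      have hend : ReachIn (fun u v => (u, v) ∈ E) A (P (e i) ∪ Q (σ (e i))) (σ (e i)) := by
        by_cases hex : (e i : V) = x
        · have hy' : σ (e i) = y := by simp [σ, hex]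
          refine .step (hP.mono hsub Set.subset_union_left) ?_ (.inr hQ.mem)
          rw [hy', hex]
          exact hxy
        · have hy' : σ (e i) = e i := by simp [σ, hex]
          rw [hy']
          exact hP.mono hsub Set.subset_union_left
      obtain ⟨b, hb, h⟩ := hend.append_reverse (hQ.mono (E' := fun u v => (v, u) ∈ E)
        (fun u v h => hsub v u h) subset_rfl)
      exact ⟨b, hb, h.mono (fun _ _ => id) (by simp [Set.union_assoc])⟩

end Menger

/-! ### Fans and internally disjoint connections -/

namespace SimpleGraph

variable {V : Type*} {G : SimpleGraph V}

theorem Subgraph.connected_of_root {H : G.Subgraph} {r : V} (hr : r ∈ H.verts)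
    (h : ∀ w ∈ H.verts, Relation.ReflTransGen H.Adj r w) : H.Connected := by
  have key : ∀ w, Relation.ReflTransGen H.Adj r w → ∀ hw : w ∈ H.verts,
      H.coe.Reachable ⟨r, hr⟩ ⟨w, hw⟩ := by
    intro w hw
    induction hw with
    | refl => exact fun _ => Reachable.refl _
    | @tail u v _ huv ih =>
      exact fun hv => (ih huv.fst_mem).trans (Adj.reachable (G := H.coe) huv)
  have : Nonempty H.verts := ⟨⟨r, hr⟩⟩
  refine Subgraph.connected_iff'.2 ⟨fun u v => ?_⟩
  exact (key u (h u u.2) u.2).symm.trans (key v (h v v.2) v.2)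

/-- `u` and `v` are joined by a walk of `G` inside `X`. -/
def JoinedIn (G : SimpleGraph V) (X : Set V) : V → V → Prop :=
  Relation.ReflTransGen fun a b => G.Adj a b ∧ a ∈ X ∧ b ∈ X

theorem JoinedIn.symm {X : Set V} {u v : V} (h : G.JoinedIn X u v) : G.JoinedIn X v u :=
  by
  induction h with
  | refl => exact .refl
  | tail _ h ih => exact .head ⟨h.1.symm, h.2.2, h.2.1⟩ ih

/-- Fewer than `k` vertices do not separate any two others. -/
def VertexConnected (G : SimpleGraph V) (k : ℕ) : Prop :=
  ∀ T : Finset V, T.card < k → ∀ u v, u ∉ T → v ∉ T → G.JoinedIn (T : Set V)ᶜ u v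

/-- The subgraph spanned by the vertices that a set of walks in `X` from `A`, a set of neighbours
of `z`, can reach, together with `z`. -/
theorem connected_induce_reachIn {E : V → V → Prop} (hE : ∀ u v, E u v → G.Adj u v)
    {A X : Set V} {z : V} (hA : ∀ a ∈ A, G.Adj z a) :
    ((⊤ : G.Subgraph).induce (insert z {w | ReachIn E A X w})).Connected := by
  refine Subgraph.connected_of_root (r := z) (Set.mem_insert _ _) ?_
  rintro w (rfl | hw)
  · exact .refl
  · induction hw with
    | base ha hX => exact .single ⟨.inl rfl, .inr (ReachIn.base ha hX), hA _ ha⟩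
    | step hu he hX ih => exact .tail ih ⟨.inr hu, .inr (ReachIn.step hu he hX), hE _ _ he⟩

/-- The fan lemma. -/
theorem VertexConnected.exists_fan [Finite V] [DecidableEq V] {k : ℕ} (hG : G.VertexConnected k)
    (z : V) (D : Finset V) (hD : D.card ≤ k) :
    ∃ F : V → G.Subgraph, (∀ d ∈ D, (F d).Connected ∧ z ∈ (F d).verts ∧ d ∈ (F d).verts) ∧
      ∀ d ∈ D, ∀ d' ∈ D, d ≠ d' → (F d).verts ∩ (F d').verts ⊆ {z} := by
  classical
  have := Fintype.ofFinite V
  have main : ∀ D : Finset V, z ∉ D → D.card ≤ k →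
      ∃ F : V → G.Subgraph, (∀ d ∈ D, (F d).Connected ∧ z ∈ (F d).verts ∧ d ∈ (F d).verts) ∧
      ∀ d ∈ D, ∀ d' ∈ D, d ≠ d' → (F d).verts ∩ (F d').verts ⊆ {z} := by
    intro D hz hD
    let E : Finset (V × V) := Finset.univ.filter fun p => G.Adj p.1 p.2
    have hL : Linked (fun u v => (u, v) ∈ E) {w | G.Adj z w} D D.card := by
      refine menger E _ _ _ fun T hT => ?_
      by_contra hlt
      push Not at hlt
      obtain ⟨d, hd, hdT⟩ : ∃ d ∈ D, d ∉ T := by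
        by_contra hno
        push Not at hno
        exact absurd (Finset.card_le_card hno) (by omega)
      -- The separator may contain `z`, but a walk starting there must be allowed to leave it; the
      -- walk after its last visit to `z` starts at a neighbour and avoids all of `T`.
      have hJ := hG (T.erase z) (by have := Finset.card_erase_le (s := T) (a := z); omega) z d
        (by simp) (by simp [hdT])
      have key : ∀ w, G.JoinedIn ((T.erase z : Finset V) : Set V)ᶜ z w →
          w = z ∨ ReachIn (fun u v => (u, v) ∈ E) {w | G.Adj z w} (T : Set V)ᶜ w := by
        intro w hw
        induction hw with
        | refl => exact .inl rfl
        | @tail u v _ huv ih =>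
          obtain ⟨hadj, _, hv⟩ := huv
          rcases eq_or_ne v z with hvz | hvz
          · exact .inl hvz
          have hvT : v ∈ (T : Set V)ᶜ := fun h => hv (by simp [hvz, Finset.mem_coe.1 h])
          rcases ih with rfl | ih
          · exact .inr (.base hadj hvT)
          · exact .inr (.step ih (by simpa [E] using hadj) hvT)
      rcases key d hJ with rfl | h
      · exact hz hd
      · exact hT d hd h
    obtain ⟨P, hPd, hPr, -⟩ := hL.exists_index rfl
    refine ⟨fun d => (⊤ : G.Subgraph).induce
      (insert z {w | ReachIn (fun u v => (u, v) ∈ E) {w | G.Adj z w} (P d) w}),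
      fun d hd => ⟨connected_induce_reachIn (by simp [E]) (by simp), Set.mem_insert _ _,
        .inr (hPr d hd)⟩, ?_⟩
    rintro d hd d' hd' hne v ⟨hv | hv, hv' | hv'⟩
    · exact hv
    · exact hv
    · exact hv'
    · exact absurd hv'.mem (Set.disjoint_left.1 (hPd d hd d' hd' hne) hv.mem)
  by_cases hz : z ∈ D
  · obtain ⟨F, hF, hF'⟩ := main (D.erase z) (by simp)
      ((Finset.card_erase_le (s := D) (a := z)).trans hD)
    refine ⟨fun d => if d = z then G.singletonSubgraph z else F d, ?_, ?_⟩
    · intro d hd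
      by_cases hdz : d = z
      · subst hdz
        simp [Subgraph.singletonSubgraph_connected]
      · simpa [hdz] using hF d (by simp [hdz, hd])
    · intro d hd d' hd' hne
      by_cases hdz : d = z
      · simp [hdz]
      · by_cases hdz' : d' = z
        · simp [hdz']
        · simpa [hdz, hdz'] using hF' d (by simp [hdz, hd]) d' (by simp [hdz', hd']) hne
  · exact main D hz hD

/-- Disjoint connected sets that touch the neighbourhoods of both `x` and `y`. -/
theorem exists_disjoint_links [Finite V] [DecidableEq V] {x y : V} {m : ℕ} (hxy : x ≠ y)
    (h : ∀ T : Finset V, T.card < m → x ∉ T → y ∉ T → ∃ w, ∃ X Y : Set V,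
      G.JoinedIn X x w ∧ G.JoinedIn Y w y ∧ (∀ v ∈ X, v ∉ T) ∧ (∀ v ∈ Y, v ∉ T) ∧
      ¬ (G.Adj x y ∧ x ∈ X ∧ y ∈ X) ∧ ¬ (G.Adj x y ∧ x ∈ Y ∧ y ∈ Y)) :
    ∃ W : Fin m → Set V, (∀ i j, i ≠ j → Disjoint (W i) (W j)) ∧
      (∀ i, x ∉ W i ∧ y ∉ W i ∧ (W i).Nonempty) ∧
      ∀ i, ∃ H : G.Subgraph, H.Connected ∧ H.verts = W i ∪ {x, y} ∧ ¬ H.Adj x y := by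
  classical
  have := Fintype.ofFinite V
  -- No arc enters `x` or `y`, so that the walks found are internal. With `y` also removed from `A`,
  -- none of them uses the edge `xy`. The walk in the hypothesis is split at `w` because each half
  -- must individually avoid having both ends of that edge available.
  let E : Finset (V × V) := Finset.univ.filter fun p => G.Adj p.1 p.2 ∧ p.2 ≠ x ∧ p.2 ≠ y
  set R : V → V → Prop := fun u v => (u, v) ∈ E with hR
  let A : Set V := {w | G.Adj x w ∧ w ≠ y}
  let B : Set V := {w | G.Adj y w}
  have hL : Linked R A B m := by
    refine menger E _ _ _ fun T hT => ?_
    by_contra hlt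
    push Not at hlt
    have hcard : ((T.erase x).erase y).card < m :=
      lt_of_le_of_lt ((Finset.card_erase_le).trans Finset.card_erase_le) hlt
    obtain ⟨w, X, Y, hX, hY, hXT, hYT, hXxy, hYxy⟩ :=
      h ((T.erase x).erase y) hcard (by simp) (by simp)
    have key : ∀ (Z : Set V), (∀ v ∈ Z, v ∉ (T.erase x).erase y) →
        ¬ (G.Adj x y ∧ x ∈ Z ∧ y ∈ Z) → ∀ a b, G.JoinedIn Z a b →
        (a = x ∨ ReachIn R A (T : Set V)ᶜ a) → b = x ∨ ReachIn R A (T : Set V)ᶜ b := by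
      intro Z hZ hZxy a b hab ha
      induction hab with
      | refl => exact ha
      | @tail u v _ huv ih =>
        obtain ⟨hadj, hu, hv⟩ := huv
        rcases eq_or_ne v x with hvx | hvx
        · exact .inl hvx
        rcases eq_or_ne v y with rfl | hvy
        · rcases ih with rfl | ih
          · exact absurd ⟨hadj, hu, hv⟩ hZxy
          · exact absurd ih (hT u hadj.symm)
        have hvT : v ∈ (T : Set V)ᶜ := fun h => hZ v hv (by simp [hvx, hvy, Finset.mem_coe.1 h])
        rcases ih with rfl | ih
        · exact .inr (.base ⟨hadj, hvy⟩ hvT)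
        · exact .inr (.step ih (by simp [hR, E, hadj, hvx, hvy]) hvT)
    have hw := (key X hXT hXxy x w hX (.inl rfl))
    have hy := key Y hYT hYxy w y hY hw
    rcases hy with hy | hy
    · exact hxy hy.symm
    · cases hy with
      | base ha _ => exact ha.2 rfl
      | step _ he _ => simp [hR, E] at he
  obtain ⟨P, hPd, hPr⟩ := hL
  have hne : ∀ i v, ReachIn R A (P i) v → v ≠ x ∧ v ≠ y := by
    intro i v hv
    cases hv with
    | base ha _ => exact ⟨ha.1.ne', ha.2⟩
    | step _ he _ =>
      simp only [hR, E, Finset.mem_filter] at he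
      exact he.2.2
  refine ⟨fun i => {w | ReachIn R A (P i) w}, ?_, ?_, ?_⟩
  · intro i j hij
    exact (hPd hij).mono (fun v hv => hv.mem) (fun v hv => hv.mem)
  · intro i
    obtain ⟨b, -, hb⟩ := hPr i
    exact ⟨fun h => (hne i _ h).1 rfl, fun h => (hne i _ h).2 rfl, b, hb⟩
  · intro i
    obtain ⟨b, hbB, hb⟩ := hPr i
    have hc := connected_induce_reachIn (G := G) (E := R) (by simp +contextual [hR, E])
      (A := A) (X := P i) (z := x) (fun a ha => ha.1)
    have hyb : G.Adj y b := hbB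
    refine ⟨_, Subgraph.connected_sup hc.preconnected
      (Subgraph.subgraphOfAdj_connected hyb).preconnected ⟨b, .inr hb, by simp⟩, ?_, ?_⟩
    · ext v
      simp only [Subgraph.verts_sup, Subgraph.induce_verts, subgraphOfAdj_verts, Set.mem_union,
        Set.mem_insert_iff, Set.mem_ofPred_eq, Set.mem_singleton_iff]
      constructor
      · rintro ((h | h) | (h | h))
        · exact .inr (.inl h)
        · exact .inl h
        · exact .inr (.inr h)
        · exact .inl (h ▸ hb)
      · rintro (h | (h | h))
        · exact .inl (.inr h)
        · exact .inl (.inl h)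
        · exact .inr (.inl h)
    · rw [Subgraph.sup_adj]
      rintro (⟨-, h | h, -⟩ | h)
      · exact hxy h.symm
      · exact (hne i y h).2 rfl
      · have := (hne i b hb).1
        simp only [subgraphOfAdj_adj, Sym2.eq_iff] at h
        rcases h with ⟨h, _⟩ | ⟨_, h⟩
        · exact hxy h.symm
        · exact this h

/-- A set `W i` offers a vertex other than `a` unless it is `{a}`. Disjointness allows this for one
`i` only, and there `x` takes its place. If `a = y` the exception never occurs, since no `W i`
contains `y`. -/
theorem exists_representatives {m : ℕ} {x y : V} (a : V) {W : Fin m → Set V}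
    (hW : ∀ i j, i ≠ j → Disjoint (W i) (W j))
    (hxy : ∀ i, x ∉ W i ∧ y ∉ W i ∧ (W i).Nonempty) :
    ∃ u : Fin m → V, Function.Injective u ∧ (∀ i, u i ≠ a) ∧ (∀ i, u i ∈ W i ∨ u i = x) ∧
      (y = a → ∀ i, u i ≠ x) := by
  have : ∀ i, ∃ t, t ≠ a ∧ ((t ∈ W i) ∨ (t = x ∧ a ∈ W i)) := by
    intro i
    by_cases h : ∃ t ∈ W i, t ≠ a
    · obtain ⟨t, ht, hta⟩ := h
      exact ⟨t, hta, .inl ht⟩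
    · push Not at h
      obtain ⟨t, ht⟩ := (hxy i).2.2
      have hta := h t ht
      subst hta
      exact ⟨x, fun h => (hxy i).1 (h ▸ ht), .inr ⟨rfl, ht⟩⟩
  choose u hua hu using this
  refine ⟨u, fun i j hij => ?_, hua, fun i => (hu i).imp id And.left, ?_⟩
  · by_contra hne
    rcases hu i with hi | ⟨hi, hi'⟩ <;> rcases hu j with hj | ⟨hj, hj'⟩
    · exact Set.disjoint_left.1 (hW i j hne) hi (hij ▸ hj)
    · exact (hxy i).1 (by rwa [← hj, ← hij])
    · exact (hxy j).1 (by rwa [← hi, hij])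
    · exact Set.disjoint_left.1 (hW i j hne) hi' hj'
  · rintro rfl i hi
    rcases hu i with h | ⟨_, h⟩
    · exact (hxy i).1 (hi ▸ h)
    · exact (hxy i).2.1 h

/-- `k` internally disjoint connections between `x` and `y`, with distinct representatives that
avoid a given vertex. -/
theorem VertexConnected.exists_connections [Fintype V] [DecidableEq V] {k : ℕ}
    (hG : G.VertexConnected k) (hV : k < Fintype.card V) {x y : V} (hxy : x ≠ y) (a : V) :
    ∃ (Q : Fin k → G.Subgraph) (u : Fin k → V),
      (∀ i, (Q i).Connected ∧ x ∈ (Q i).verts ∧ y ∈ (Q i).verts ∧ u i ∈ (Q i).verts) ∧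
      Function.Injective u ∧ (∀ i, u i ≠ a) ∧
      (∀ i j, i ≠ j → (Q i).verts ∩ (Q j).verts ⊆ {x, y}) ∧
      ∀ i j, i ≠ j → (Q i).Adj x y → ¬ (Q j).Adj x y := by
  by_cases hadj : G.Adj x y
  · rcases k with _ | m
    · exact ⟨fun i => i.elim0, fun i => i.elim0, fun i => i.elim0, fun i => i.elim0,
        fun i => i.elim0, fun i => i.elim0, fun i => i.elim0⟩
    obtain ⟨W, hWd, hW, hH⟩ := exists_disjoint_links (G := G) (m := m) hxy (by
      intro T hT hxT hyT
      have hcx := Finset.card_insert_le x T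
      have hcy := Finset.card_insert_le y T
      have hcxy := Finset.card_insert_le x (insert y T)
      -- The edge `xy` is itself one connection, so only `m = k - 1` more are needed. There is room
      -- to delete `y` as well on the way from `x` to `w`, and `x` on the way from `w` to `y`.
      obtain ⟨w, hw⟩ : ∃ w, w ∉ insert x (insert y T) := by
        by_contra hno
        push Not at hno
        have := Finset.card_le_card (fun v _ => hno v : Finset.univ ⊆ insert x (insert y T))
        rw [Finset.card_univ] at this
        omega
      simp only [Finset.mem_insert, not_or] at hw
      refine ⟨w, ((insert y T : Finset V) : Set V)ᶜ,
        ((insert x T : Finset V) : Set V)ᶜ,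
        hG _ (by omega) _ _ (by simp [hxy, hxT]) (by simp [hw.2]),
        hG _ (by omega) _ _ (by simp [hw.1, hw.2.2]) (by simp [hxy.symm, hyT]), ?_, ?_, ?_, ?_⟩
      · intro v hv hvT
        exact hv (by simp [hvT])
      · intro v hv hvT
        exact hv (by simp [hvT])
      · simp
      · simp)
    choose H hHc hHv hHxy using hH
    obtain ⟨u, huinj, hua, hu, huy⟩ := exists_representatives a hWd hW
    -- The representative of the edge is `y`, or `x` if `y` is forbidden; in the latter case no
    -- other connection is represented by `x`.
    obtain ⟨t, ht, hta, htu⟩ : ∃ t, (t = x ∨ t = y) ∧ t ≠ a ∧ ∀ i, u i ≠ t := by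
      by_cases hya : y = a
      · exact ⟨x, .inl rfl, fun h => hxy (h.trans hya.symm), huy hya⟩
      · refine ⟨y, .inr rfl, hya, fun i hi => ?_⟩
        rcases hu i with h | h
        · exact (hW i).2.1 (hi ▸ h)
        · exact hxy (h.symm.trans hi)
    refine ⟨Fin.cons (G.subgraphOfAdj hadj) H, Fin.cons t u, ?_, ?_, ?_, ?_, ?_⟩
    · refine Fin.cases ?_ fun i => ?_
      · simpa [Subgraph.subgraphOfAdj_connected] using ht
      · simp only [Fin.cons_succ, hHv]
        refine ⟨hHc i, by simp, by simp, ?_⟩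
        rcases hu i with h | h <;> simp [h]
    · exact Fin.cons_injective_iff.2 ⟨by rintro ⟨i, hi⟩; exact htu i hi, huinj⟩
    · exact Fin.cases (by simpa using hta) (by simpa using hua)
    · refine Fin.cases (Fin.cases (by simp) fun j _ => by simp)
        fun i => Fin.cases (fun _ => by simp) fun j hij => ?_
      simp only [Fin.cons_succ, hHv]
      rintro v ⟨h | h, h' | h'⟩
      · exact absurd h' (Set.disjoint_left.1 (hWd i j fun h => hij (h ▸ rfl)) h)
      all_goals assumption
    · refine Fin.cases (Fin.cases (by simp) fun j _ _ => by simpa using hHxy j)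
        fun i => fun j _ h => absurd h (by simpa using hHxy i)
  · obtain ⟨W, hWd, hW, hH⟩ := exists_disjoint_links (G := G) (m := k) hxy (by
      intro T hT hxT hyT
      exact ⟨y, (T : Set V)ᶜ, (T : Set V)ᶜ, hG T hT _ _ hxT hyT, .refl,
        fun v hv => hv, fun v hv => hv, fun h => hadj h.1, fun h => hadj h.1⟩)
    choose H hHc hHv hHxy using hH
    obtain ⟨u, huinj, hua, hu, -⟩ := exists_representatives a hWd hW
    refine ⟨H, u, fun i => ⟨hHc i, by simp [hHv], by simp [hHv], ?_⟩, huinj, hua, ?_,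
      fun i j _ h => absurd h.adj_sub hadj⟩
    · rcases hu i with h | h <;> simp [hHv, h]
    · intro i j hij
      simp only [hHv]
      rintro v ⟨h | h, h' | h'⟩
      · exact absurd h' (Set.disjoint_left.1 (hWd i j hij) h)
      all_goals assumption

end SimpleGraph

/-! ### Hypercubes and folded hypercubes, and their connectivity -/

open scoped symmDiff

namespace BinString

/-- The unit strings, and the all-ones string for `none`. -/
def gen {n : ℕ} : Option (Fin n) → BinString n
  | some i => fun j => decide (j = i)
  | none => fun _ => true

variable {n : ℕ}

theorem compl_eq_symmDiff (u : BinString n) : u.compl = u ∆ gen none := by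
  funext j
  simp [compl, gen, Pi.symmDiff_apply, Bool.symmDiff_eq_xor]

theorem hammingDist_eq_one_iff {u v : BinString n} :
    hammingDist u v = 1 ↔ ∃ i, v = u ∆ gen (some i) := by
  rw [hammingDist, Finset.card_eq_one]
  refine exists_congr fun i => ?_
  simp only [Finset.ext_iff, Finset.mem_filter, Finset.mem_univ, true_and, Finset.mem_singleton,
    funext_iff, gen, Pi.symmDiff_apply, Bool.symmDiff_eq_xor]
  refine forall_congr' fun j => ?_
  by_cases hj : j = i <;> cases u j <;> cases v j <;> simp [hj]

theorem gen_ne_bot (hn : 1 ≤ n) (o : Option (Fin n)) : gen o ≠ ⊥ := by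
  intro h
  rcases o with _ | i
  · simpa [gen] using congrFun h ⟨0, hn⟩
  · simpa [gen] using congrFun h i

theorem symmDiff_gen_ne (hn : 1 ≤ n) (o : Option (Fin n)) (u : BinString n) : u ∆ gen o ≠ u := by
  intro h
  exact gen_ne_bot hn o (by simpa using congrArg (u ∆ ·) h)

theorem gen_injective (hn : 2 ≤ n) : Function.Injective (gen : Option (Fin n) → BinString n) := by
  have key : ∀ i : Fin n, gen (some i) ≠ gen none := by
    intro i h
    have : Nontrivial (Fin n) := Fin.nontrivial_iff_two_le.2 hn
    obtain ⟨j, hj⟩ := exists_ne i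
    simpa [gen, hj] using congrFun h j
  rintro (_ | i) (_ | j) h
  · rfl
  · exact absurd h.symm (key j)
  · exact absurd h (key i)
  · simpa [gen] using congrFun h i

theorem cons_symmDiff_gen_zero (b : Bool) (w : BinString n) :
    (Fin.cons b w : BinString (n + 1)) ∆ gen (some 0) = (Fin.cons (!b) w : BinString (n + 1)) := by
  funext j
  refine Fin.cases ?_ (fun j => ?_) j
  · simp [gen, Pi.symmDiff_apply, Bool.symmDiff_eq_xor]
  · simp [gen, Pi.symmDiff_apply, Bool.symmDiff_eq_xor, Fin.succ_ne_zero]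

theorem cons_symmDiff_gen_succ (b : Bool) (w : BinString n) (i : Fin n) :
    (Fin.cons b w : BinString (n + 1)) ∆ gen (some i.succ) =
      (Fin.cons b (w ∆ gen (some i)) : BinString (n + 1)) := by
  funext j
  refine Fin.cases ?_ (fun j => ?_) j
  · simp [gen, Pi.symmDiff_apply, Bool.symmDiff_eq_xor, (Fin.succ_ne_zero _).symm]
  · simp [gen, Pi.symmDiff_apply, Bool.symmDiff_eq_xor]

theorem cons_symmDiff_gen_none (b : Bool) (w : BinString n) :
    (Fin.cons b w : BinString (n + 1)) ∆ gen none =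
      (Fin.cons (!b) (w ∆ gen none) : BinString (n + 1)) := by
  funext j
  refine Fin.cases ?_ (fun j => ?_) j <;> simp [gen, Pi.symmDiff_apply, Bool.symmDiff_eq_xor]

/-- The strings `w` for which `b` followed by `w` lies in `T`. -/
def half (T : Finset (BinString (n + 1))) (b : Bool) : Finset (BinString n) :=
  Finset.univ.filter fun w => (Fin.cons b w : BinString (n + 1)) ∈ T

theorem mem_half {T : Finset (BinString (n + 1))} {b : Bool} {w : BinString n} :
    w ∈ half T b ↔ (Fin.cons b w : BinString (n + 1)) ∈ T := by simp [half]

theorem card_half_add (T : Finset (BinString (n + 1))) (b : Bool) :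
    (half T b).card + (half T (!b)).card ≤ T.card := by
  have hinj : ∀ b, Function.Injective fun w : BinString n => (Fin.cons b w : BinString (n + 1)) :=
    fun b => Fin.cons_right_injective (α := fun _ => Bool) b
  rw [← Finset.card_image_of_injective (half T b) (hinj b),
    ← Finset.card_image_of_injective (half T (!b)) (hinj (!b)), ← Finset.card_union_of_disjoint]
  · refine Finset.card_le_card fun v hv => ?_
    simp only [Finset.mem_union, Finset.mem_image, mem_half] at hv
    rcases hv with ⟨w, hw, rfl⟩ | ⟨w, hw, rfl⟩ <;> exact hw
  · rw [Finset.disjoint_left]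
    intro v hv hv'
    obtain ⟨w, _, rfl⟩ := Finset.mem_image.1 hv
    obtain ⟨w', _, h⟩ := Finset.mem_image.1 hv'
    simpa using congrFun h 0

/-- The connectivity of a graph on strings of length `n + 1` from that of one half. -/
theorem joinedIn_of_half {G : SimpleGraph (BinString (n + 1))} {T : Finset (BinString (n + 1))}
    (b : Bool)
    (hb : ∀ u v, u ∉ half T b → v ∉ half T b → G.JoinedIn (T : Set (BinString (n + 1)))ᶜ
      (Fin.cons b u : BinString (n + 1)) (Fin.cons b v : BinString (n + 1)))
    (hb' : ∀ u, u ∉ half T (!b) → ∃ w, w ∉ half T b ∧ G.JoinedIn (T : Set (BinString (n + 1)))ᶜ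
      (Fin.cons (!b) u : BinString (n + 1)) (Fin.cons b w : BinString (n + 1)))
    (u v : BinString (n + 1)) (hu : u ∉ T) (hv : v ∉ T) :
    G.JoinedIn (T : Set (BinString (n + 1)))ᶜ u v := by
  have key : ∀ u : BinString (n + 1), u ∉ T → ∃ w, w ∉ half T b ∧
      G.JoinedIn (T : Set (BinString (n + 1)))ᶜ u (Fin.cons b w : BinString (n + 1)) := by
    intro u
    induction u using Fin.consCases with
    | _ c u =>
      intro hu
      by_cases hc : c = b
      · subst hc
        exact ⟨u, by rwa [mem_half], .refl⟩
      · obtain rfl : c = !b := by cases c <;> cases b <;> simp_all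
        exact hb' u (by rwa [mem_half])
  obtain ⟨w, hw, huw⟩ := key u hu
  obtain ⟨w', hw', hvw⟩ := key v hv
  exact huw.trans ((hb w w' hw hw').trans hvw.symm)

/-- The hypercube. -/
def cube (n : ℕ) : SimpleGraph (BinString n) where
  Adj u v := ∃ i, v = u ∆ gen (some i)
  symm := ⟨by
    rintro u v ⟨i, rfl⟩
    exact ⟨i, by simp⟩⟩
  loopless := ⟨by
    rintro u ⟨i, hi⟩
    exact symmDiff_gen_ne i.pos _ _ hi.symm⟩

theorem joinedIn_cons {G : SimpleGraph (BinString (n + 1))} {T : Finset (BinString (n + 1))}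
    (hG : cube (n + 1) ≤ G) (b : Bool) {u v : BinString n}
    (h : (cube n).JoinedIn (half T b : Set (BinString n))ᶜ u v) :
    G.JoinedIn (T : Set (BinString (n + 1)))ᶜ
      (Fin.cons b u : BinString (n + 1)) (Fin.cons b v : BinString (n + 1)) := by
  refine Relation.ReflTransGen.lift (fun w => (Fin.cons b w : BinString (n + 1))) ?_ _ _ h
  rintro u v ⟨⟨i, rfl⟩, hu, hv⟩
  refine ⟨hG ⟨i.succ, (cons_symmDiff_gen_succ b u i).symm⟩, ?_, ?_⟩
  · simpa [mem_half] using hu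
  · simpa [mem_half] using hv

theorem adj_cons_not {G : SimpleGraph (BinString (n + 1))} (hG : cube (n + 1) ≤ G) (b : Bool)
    (w : BinString n) : G.Adj (Fin.cons (!b) w : BinString (n + 1))
      (Fin.cons b w : BinString (n + 1)) :=
  hG ⟨0, by rw [cons_symmDiff_gen_zero, Bool.not_not]⟩

/-- Two connected halves are joined by one of the edges between them. -/
theorem joinedIn_of_halves {G : SimpleGraph (BinString (n + 1))} {T : Finset (BinString (n + 1))}
    (hG : cube (n + 1) ≤ G) (hT : T.card < 2 ^ n)
    (h : ∀ b u v, u ∉ half T b → v ∉ half T b →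
      (cube n).JoinedIn (half T b : Set (BinString n))ᶜ u v)
    (u v : BinString (n + 1)) (hu : u ∉ T) (hv : v ∉ T) :
    G.JoinedIn (T : Set (BinString (n + 1)))ᶜ u v := by
  obtain ⟨w, hw⟩ : ∃ w, w ∉ half T true ∪ half T false := by
    by_contra hno
    push Not at hno
    have h1 := Finset.card_le_card (fun v _ => hno v : Finset.univ ⊆ half T true ∪ half T false)
    have h2 := Finset.card_union_le (half T true) (half T false)
    have h3 := card_half_add T true
    simp only [Finset.card_univ, Fintype.card_pi, Fintype.card_bool, Finset.prod_const,
      Fintype.card_fin, Bool.not_true] at h1 h3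
    omega
  simp only [Finset.mem_union, not_or] at hw
  refine joinedIn_of_half true (fun u v hu hv => joinedIn_cons hG true (h true u v hu hv))
    (fun u hu => ⟨w, hw.1, (joinedIn_cons hG (!true) (h (!true) u w hu hw.2)).tail ?_⟩) u v hu hv
  exact ⟨adj_cons_not hG true w, by simpa [mem_half] using hw.2, by simpa [mem_half] using hw.1⟩

/-- Induction on the dimension. Either both halves stay connected and one of the `2 ^ n` edges
between them survives, or all deleted vertices lie in one half and the other half is intact. The
alternative `T = ∅` keeps the induction alive in dimension zero, where no set has fewer than zero
elements. -/
theorem joinedIn_cube : ∀ (n : ℕ) (T : Finset (BinString n)), T.card < n ∨ T = ∅ →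
    ∀ u v, u ∉ T → v ∉ T → (cube n).JoinedIn (T : Set (BinString n))ᶜ u v := by
  intro n
  induction n with
  | zero =>
    intro T _ u v _ _
    rw [Subsingleton.elim u v]
    exact .refl
  | succ n ih =>
    intro T hT
    have hpow : n < 2 ^ n := Nat.lt_two_pow_self
    have hcard : T.card < n + 1 := hT.elim id fun h => by simp [h]
    by_cases hboth : ∀ b, (half T b).card < n ∨ half T b = ∅
    · exact joinedIn_of_halves le_rfl (by omega) fun b => ih _ (hboth b)
    · push Not at hboth
      obtain ⟨b, hb, _⟩ := hboth
      have hsum := card_half_add T b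
      have hempty : half T (!b) = ∅ := Finset.card_eq_zero.1 (by omega)
      refine joinedIn_of_half (!b)
        (fun u v hu hv => joinedIn_cons le_rfl _ (ih _ (.inr hempty) u v hu hv)) fun u hu => ?_
      refine ⟨u, by simp [hempty], .single ⟨adj_cons_not le_rfl (!b) u, ?_, ?_⟩⟩
      · simpa [mem_half] using hu
      · have : u ∉ half T (!b) := by simp [hempty]
        simpa [mem_half] using this

/-- The folded hypercube. -/
def foldedCube (n : ℕ) : SimpleGraph (BinString n) where
  Adj u v := u ≠ v ∧ ∃ o, v = u ∆ gen o
  symm := ⟨by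
    rintro u _ ⟨hne, o, rfl⟩
    exact ⟨hne.symm, o, by simp⟩⟩
  loopless := ⟨fun u h => h.1 rfl⟩

theorem foldedCube_adj_iff (hn : 1 ≤ n) {u v : BinString n} :
    (foldedCube n).Adj u v ↔ ∃ o, v = u ∆ gen o := by
  refine ⟨And.right, fun h => ⟨?_, h⟩⟩
  rintro rfl
  obtain ⟨o, ho⟩ := h
  exact symmDiff_gen_ne hn o _ ho.symm

theorem cube_le_foldedCube : cube n ≤ foldedCube n :=
  fun _ _ h => ⟨h.ne, let ⟨i, hi⟩ := h; ⟨some i, hi⟩⟩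

/-- If neither half loses as many vertices as its dimension, both are connected and an edge between
them survives. Otherwise the other half loses at most one vertex and stays connected, and every
vertex has two neighbours in it. -/
theorem foldedCube_vertexConnected (hn : 3 ≤ n) : (foldedCube n).VertexConnected (n + 1) := by
  obtain ⟨n, rfl⟩ : ∃ m, n = m + 1 := ⟨n - 1, by omega⟩
  intro T hT
  have hpow : n + 1 < 2 ^ n := by
    obtain ⟨m, rfl⟩ : ∃ m, n = m + 2 := ⟨n - 2, by omega⟩
    have : m < 2 ^ m := Nat.lt_two_pow_self
    rw [pow_add]
    omega
  by_cases hboth : ∀ b, (half T b).card < n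
  · exact joinedIn_of_halves cube_le_foldedCube (by omega)
      fun b => joinedIn_cube n _ (.inl (hboth b))
  · push Not at hboth
    obtain ⟨b, hb⟩ := hboth
    have hsum := card_half_add T b
    refine joinedIn_of_half (!b) (fun u v hu hv => joinedIn_cons cube_le_foldedCube _
      (joinedIn_cube n _ (.inl (by omega)) u v hu hv)) fun u hu => ?_
    rw [mem_half, Bool.not_not] at hu
    obtain ⟨w, hw, hadj⟩ : ∃ w, w ∉ half T (!b) ∧ (foldedCube (n + 1)).Adj
        (Fin.cons b u : BinString (n + 1)) (Fin.cons (!b) w : BinString (n + 1)) := by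
      -- The two neighbours in the opposite half come from flipping the first bit and from
      -- complementing; at most one of them is deleted.
      by_cases h1 : u ∈ half T (!b)
      · refine ⟨u ∆ gen none, fun h2 => ?_, (foldedCube_adj_iff (by omega)).2
          ⟨none, (cons_symmDiff_gen_none b u).symm⟩⟩
        have hle : (half T (!b)).card ≤ 1 := by omega
        exact symmDiff_gen_ne (by omega) none u (Finset.card_le_one.1 hle _ h2 _ h1)
      · exact ⟨u, h1, by simpa using adj_cons_not cube_le_foldedCube (!b) u⟩
    refine ⟨w, hw, .single ⟨by simpa using hadj, by simpa using hu, by simpa [mem_half] using hw⟩⟩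

/-! ### Relations among the generators, and common neighbours -/

theorem foldr_gen_apply (l : List (Option (Fin n))) (j : Fin n) :
    (l.map gen).foldr (· ∆ ·) ⊥ j = decide (Odd (l.count (some j) + l.count none)) := by
  induction l with
  | nil => simp
  | cons o l ih =>
    simp only [List.map_cons, List.foldr_cons, Pi.symmDiff_apply, ih, Bool.symmDiff_eq_xor]
    rcases o with _ | i
    · simp only [gen, List.count_cons, beq_self_eq_true, if_true]
      rw [Bool.eq_iff_iff]
      simp only [Bool.true_xor, Bool.not_eq_true', decide_eq_false_iff_not, decide_eq_true_eq]
      simp [← add_assoc, Nat.odd_add_one]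
    · by_cases hj : j = i
      · subst hj
        rw [Bool.eq_iff_iff]
        simp [gen, add_right_comm _ 1, Nat.odd_add_one]
      · simp [gen, hj, Ne.symm hj]

/-- The only dependency among the generators is that all of them sum to zero. -/
theorem even_or_odd_of_foldr_gen {l : List (Option (Fin n))}
    (h : (l.map gen).foldr (· ∆ ·) ⊥ = ⊥) :
    (∀ o, Even (l.count o)) ∨ ∀ o, Odd (l.count o) := by
  have key : ∀ j, ¬ Odd (l.count (some j) + l.count none) := fun j => by
    have := congrFun h j
    rw [foldr_gen_apply] at this
    simpa using this
  simp only [Nat.not_odd_iff_even, Nat.even_add] at key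
  rcases Nat.even_or_odd (l.count none) with h0 | h0
  · exact .inl (Option.rec h0 fun j => (key j).2 h0)
  · refine .inr (Option.rec h0 fun j => ?_)
    rw [← Nat.not_even_iff_odd] at h0 ⊢
    exact fun h => h0 ((key j).1 h)

theorem lt_length_of_odd {l : List (Option (Fin n))} (h : ∀ o, Odd (l.count o)) :
    n + 1 ≤ l.length := by
  have : (Finset.univ : Finset (Option (Fin n))) ⊆ l.toFinset := fun o _ => by
    rw [List.mem_toFinset, ← List.count_pos_iff]
    exact (h o).pos
  calc n + 1 = (Finset.univ : Finset (Option (Fin n))).card := by simp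
    _ ≤ l.toFinset.card := Finset.card_le_card this
    _ ≤ l.length := l.toFinset_card_le

/-- The neighbours of a vertex of the folded hypercube. -/
def nbrs (u : BinString n) : Finset (BinString n) := Finset.univ.image fun o => u ∆ gen o

theorem mem_nbrs {u v : BinString n} : v ∈ nbrs u ↔ ∃ o, v = u ∆ gen o := by
  simp [nbrs, eq_comm]

theorem foldedCube_adj_iff_mem_nbrs (hn : 1 ≤ n) {u v : BinString n} :
    (foldedCube n).Adj u v ↔ v ∈ nbrs u := by
  rw [foldedCube_adj_iff hn, mem_nbrs]

theorem mem_nbrs_comm {u v : BinString n} : v ∈ nbrs u ↔ u ∈ nbrs v := by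
  simp only [mem_nbrs]
  constructor <;> rintro ⟨o, rfl⟩ <;> exact ⟨o, by simp⟩

theorem not_mem_nbrs_self (hn : 1 ≤ n) (u : BinString n) : u ∉ nbrs u := by
  rw [mem_nbrs]
  rintro ⟨o, ho⟩
  exact symmDiff_gen_ne hn o u ho.symm

theorem card_nbrs (hn : 2 ≤ n) (u : BinString n) : (nbrs u).card = n + 1 := by
  have : Function.Injective fun o => u ∆ gen o :=
    (symmDiff_right_injective u).comp (gen_injective hn)
  simp [nbrs, Finset.card_image_of_injective _ this]

/-- A triangle is a relation of length three. The counts cannot all be even, since three is odd, and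
cannot all be odd, since there are at least four generators. -/
theorem triangle_free (hn : 3 ≤ n) {x y z : BinString n} (hxy : y ∈ nbrs x) (hyz : z ∈ nbrs y)
    (hxz : z ∈ nbrs x) : False := by
  obtain ⟨a, rfl⟩ := mem_nbrs.1 hxy
  obtain ⟨b, rfl⟩ := mem_nbrs.1 hyz
  obtain ⟨c, hc⟩ := mem_nbrs.1 hxz
  have h : (([a, b, c] : List (Option (Fin n))).map gen).foldr (· ∆ ·) ⊥ = ⊥ := by
    rw [symmDiff_assoc] at hc
    have := symmDiff_right_injective x hc
    simp [← symmDiff_assoc, this]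
  rcases even_or_odd_of_foldr_gen h with h | h
  · rcases eq_or_ne a b with rfl | hab
    · have := h c
      rcases eq_or_ne a c with rfl | hac
      · simp [Nat.even_add_one] at this
      · simp [hac] at this
    · rcases eq_or_ne a c with rfl | hac
      · have := h b
        simp [hab] at this
      · have := h a
        simp [hab.symm, hac.symm] at this
  · have := lt_length_of_odd h
    simp at this
    omega

theorem sum_four {x y w w' : BinString n} {a b c d : Option (Fin n)} (ha : w = x ∆ gen a)
    (hb : w = y ∆ gen b) (hc : w' = x ∆ gen c) (hd : w' = y ∆ gen d) :
    (([a, b, c, d] : List (Option (Fin n))).map gen).foldr (· ∆ ·) ⊥ = ⊥ := by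
  funext j
  have ha := congrFun ha j
  have hb := congrFun hb j
  have hc := congrFun hc j
  have hd := congrFun hd j
  simp only [List.map_cons, List.map_nil, List.foldr_cons, List.foldr_nil, Pi.symmDiff_apply,
    Bool.symmDiff_eq_xor, Pi.bot_apply] at *
  revert ha hb hc hd
  generalize x j = x; generalize y j = y; generalize w j = w; generalize w' j = w'
  generalize gen a j = a; generalize gen b j = b; generalize gen c j = c; generalize gen d j = d
  revert x y w w' a b c d
  decide

/-- Two common neighbours `w`, `w'` of `x ≠ y` in terms of the generators leading to them. -/
theorem common_cases (hn : 4 ≤ n) {x y w w' : BinString n} (hxy : x ≠ y)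
    {a b c d : Option (Fin n)} (ha : w = x ∆ gen a) (hb : w = y ∆ gen b) (hc : w' = x ∆ gen c)
    (hd : w' = y ∆ gen d) : a = c ∨ a = d := by
  have hab : a ≠ b := by
    rintro rfl
    exact hxy (symmDiff_left_injective _ (ha.symm.trans hb))
  rcases even_or_odd_of_foldr_gen (sum_four ha hb hc hd) with h | h
  · have := h a
    by_contra hno
    push Not at hno
    simp [hab.symm, hno.1.symm, hno.2.symm] at this
  · have := lt_length_of_odd h
    simp at this
    omega

/-- Given a common neighbour `w`, the generator from `x` to `w` recurs on one of the two edges at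
any other common neighbour: from `x`, which gives `w` again, or from `y`, which gives the opposite
corner of the 4-cycle. -/
theorem card_common_le_two (hn : 4 ≤ n) {x y : BinString n} (hxy : x ≠ y) :
    (nbrs x ∩ nbrs y).card ≤ 2 := by
  rcases (nbrs x ∩ nbrs y).eq_empty_or_nonempty with h | ⟨w, hw⟩
  · simp [h]
  · refine (Finset.card_le_card (t := {w, y ∆ (x ∆ w)}) ?_).trans Finset.card_le_two
    intro w' hw'
    rw [Finset.mem_inter, mem_nbrs, mem_nbrs] at hw hw'
    obtain ⟨⟨a, ha⟩, b, hb⟩ := hw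
    obtain ⟨⟨c, hc⟩, d, hd⟩ := hw'
    rw [Finset.mem_insert, Finset.mem_singleton]
    rcases common_cases hn hxy ha hb hc hd with rfl | rfl
    · exact .inl (hc.trans ha.symm)
    · right
      rw [ha, hd]
      simp

/-- In dimension four the bound `2 + 2 + 2` exceeds `n + 1 = 5`. A vertex common to all three
neighbourhoods brings it down to four. -/
theorem exists_common_of_four {x y z w₁ w₂ w₃ : BinString 4} (hxy : x ≠ y) (hxz : x ≠ z)
    (hyz : y ≠ z) (h₁ : w₁ ∈ nbrs x ∩ nbrs y) (h₂ : w₂ ∈ nbrs x ∩ nbrs z)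
    (h₃ : w₃ ∈ nbrs y ∩ nbrs z) : ∃ t, t ∈ nbrs x ∧ t ∈ nbrs y ∧ t ∈ nbrs z := by
  simp only [Finset.mem_inter, mem_nbrs] at *
  obtain ⟨⟨a, ha⟩, b, hb⟩ := h₁
  obtain ⟨⟨c, hc⟩, d, hd⟩ := h₂
  obtain ⟨⟨f, hf⟩, g, hg⟩ := h₃
  have hab : a ≠ b := by
    rintro rfl
    exact hxy (symmDiff_left_injective _ (ha.symm.trans hb))
  have hcd : c ≠ d := by
    rintro rfl
    exact hxz (symmDiff_left_injective _ (hc.symm.trans hd))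
  have hfg : f ≠ g := by
    rintro rfl
    exact hyz (symmDiff_left_injective _ (hf.symm.trans hg))
  have hy : y = x ∆ gen a ∆ gen b := by rw [← ha, hb]; simp
  have hz : z = x ∆ gen c ∆ gen d := by rw [← hc, hd]; simp
  have hz' : z = y ∆ gen f ∆ gen g := by rw [← hf, hg]; simp
  have hsum : (([a, b, c, d, f, g] : List (Option (Fin 4))).map gen).foldr (· ∆ ·) ⊥ = ⊥ := by
    have : x ∆ gen c ∆ gen d = x ∆ gen a ∆ gen b ∆ gen f ∆ gen g := by rw [← hz, ← hy, hz']
    simp only [symmDiff_assoc] at this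
    have := symmDiff_right_injective x this
    simp only [List.map_cons, List.map_nil, List.foldr_cons, List.foldr_nil, symmDiff_bot]
    rw [← symmDiff_assoc (gen c), this, symmDiff_assoc, symmDiff_assoc, symmDiff_assoc,
      symmDiff_left_comm (gen g), symmDiff_self, symmDiff_left_comm (gen b)]
    simp
  have heven : ∀ o, Even (([a, b, c, d, f, g] : List (Option (Fin 4))).count o) := by
    -- Five odd counts have an odd sum, but the list has length six.
    refine (even_or_odd_of_foldr_gen hsum).resolve_right fun h => ?_
    have hlen : ∑ o, ([a, b, c, d, f, g] : List (Option (Fin 4))).count o = 6 := by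
      simp only [List.count_cons, List.count_nil, Finset.sum_add_distrib, beq_iff_eq,
        Finset.sum_ite_eq, Finset.mem_univ, if_true, Finset.sum_const_zero]
    have := Finset.odd_sum_iff_odd_card_odd (s := Finset.univ)
      (fun o => ([a, b, c, d, f, g] : List (Option (Fin 4))).count o)
    rw [hlen] at this
    simp [h] at this
    revert this
    decide
  -- Otherwise `a`, `b`, `c`, `d` are four different generators, and `f`, `g` cannot make all four
  -- counts even.
  have key : a = c ∨ a = d ∨ b = c ∨ b = d := by
    by_contra hno
    push Not at hno
    obtain ⟨h1, h2, h3, h4⟩ := hno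
    have hc' := heven c
    have hd' := heven d
    have hsub : c = f ∨ c = g := by
      by_contra hno
      push Not at hno
      simp [h1, h3, hcd.symm, hno.1.symm, hno.2.symm] at hc'
    have hsub' : a = f ∨ a = g := by
      by_contra hno
      push Not at hno
      have := heven a
      simp [h1.symm, h2.symm, hab.symm, hno.1.symm, hno.2.symm] at this
    have hsub'' : b = f ∨ b = g := by
      by_contra hno
      push Not at hno
      have := heven b
      simp [h3.symm, h4.symm, hab, hno.1.symm, hno.2.symm] at this
    grind
  rcases key with rfl | rfl | rfl | rfl
  · exact ⟨w₁, ⟨a, ha⟩, ⟨b, hb⟩, d, by rw [hz, ha]; simp⟩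
  · exact ⟨w₁, ⟨a, ha⟩, ⟨b, hb⟩, c, by rw [hz, ha, symmDiff_right_comm]; simp⟩
  · exact ⟨w₂, ⟨b, hc⟩, ⟨a, by rw [hy, hc, symmDiff_right_comm]; simp⟩, d, hd⟩
  · exact ⟨x ∆ gen b, ⟨b, rfl⟩, ⟨a, by rw [hy, symmDiff_right_comm]; simp⟩,
      c, by rw [hz, symmDiff_right_comm]; simp⟩

theorem card_two_sums_three :
    (Finset.univ.image fun p : Option (Fin 3) × Option (Fin 3) =>
      (gen p.1 ∆ gen p.2 : BinString 3)).card = 4 := by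
  decide +kernel

/-- The vertices adjacent to at least two of `x`, `y`, `z`. -/
def commonNbrs (x y z : BinString n) : Finset (BinString n) :=
  (nbrs x ∩ nbrs y) ∪ (nbrs x ∩ nbrs z) ∪ (nbrs y ∩ nbrs z)

theorem _root_.Finset.card_union_union_le_four {α : Type*} [DecidableEq α] {A B C : Finset α}
    (hA : A.card ≤ 2) (hB : B.card ≤ 2) (hC : C.card ≤ 2)
    (h : A = ∅ ∨ B = ∅ ∨ C = ∅ ∨ ∃ t, t ∈ A ∧ t ∈ B ∧ t ∈ C) : (A ∪ B ∪ C).card ≤ 4 := by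
  have h1 := Finset.card_union_le (A ∪ B) C
  have h2 := Finset.card_union_le A B
  rcases h with h | h | h | ⟨t, ha, hb, hc⟩
  · rw [h, Finset.card_empty] at h2
    rw [h] at h1 ⊢
    omega
  · rw [h, Finset.card_empty] at h2
    rw [h] at h1 ⊢
    omega
  · rw [h, Finset.card_empty] at h1
    rw [h]
    omega
  · have hsub : A ∪ B ∪ C ⊆ insert t (A.erase t ∪ B.erase t ∪ C.erase t) := by
      intro v hv
      simp only [Finset.mem_union, Finset.mem_insert, Finset.mem_erase] at hv ⊢
      tauto
    have hc' := Finset.card_le_card hsub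
    have e1 := Finset.card_erase_of_mem ha
    have e2 := Finset.card_erase_of_mem hb
    have e3 := Finset.card_erase_of_mem hc
    have i1 := Finset.card_insert_le t (A.erase t ∪ B.erase t ∪ C.erase t)
    have i2 := Finset.card_union_le (A.erase t ∪ B.erase t) (C.erase t)
    have i3 := Finset.card_union_le (A.erase t) (B.erase t)
    omega

/-- Two vertices that are each adjacent to two of `x`, `y`, `z` share one of these neighbours, so
they differ by a sum of two generators. There are only four such sums in dimension three. -/
theorem card_commonNbrs_three (x y z : BinString 3) : (commonNbrs x y z).card ≤ 4 := by
  rcases (commonNbrs x y z).eq_empty_or_nonempty with h | ⟨w, hw⟩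
  · simp [h]
  refine le_trans (Finset.card_le_card (t := (Finset.univ.image
    fun p : Option (Fin 3) × Option (Fin 3) => (gen p.1 ∆ gen p.2 : BinString 3)).image
    fun v => w ∆ v) fun v hv => ?_) (Finset.card_image_le.trans card_two_sums_three.le)
  have key : ∃ u, u ∈ nbrs v ∧ u ∈ nbrs w := by
    simp only [commonNbrs, Finset.mem_union, Finset.mem_inter] at hv hw
    simp only [mem_nbrs_comm (v := v), mem_nbrs_comm (v := w)] at hv hw
    rcases hv with (hv | hv) | hv <;> rcases hw with (hw | hw) | hw <;>
      first
      | exact ⟨x, hv.1, hw.1⟩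
      | exact ⟨y, hv.2, hw.2⟩
      | exact ⟨y, hv.2, hw.1⟩
      | exact ⟨y, hv.1, hw.2⟩
      | exact ⟨y, hv.1, hw.1⟩
      | exact ⟨z, hv.2, hw.2⟩
  obtain ⟨u, hu, hu'⟩ := key
  obtain ⟨b, hb⟩ := mem_nbrs.1 (mem_nbrs_comm.1 hu)
  obtain ⟨a, rfl⟩ := mem_nbrs.1 hu'
  simp only [Finset.mem_image, Finset.mem_univ, true_and, Prod.exists]
  exact ⟨_, ⟨a, b, rfl⟩, by rw [hb, symmDiff_assoc]⟩

theorem card_commonNbrs_le (hn : 3 ≤ n) {x y z : BinString n} (hxy : x ≠ y) (hxz : x ≠ z)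
    (hyz : y ≠ z) : (commonNbrs x y z).card ≤ n + 1 := by
  rcases (by omega : n = 3 ∨ n = 4 ∨ 5 ≤ n) with rfl | rfl | hn
  · exact card_commonNbrs_three x y z
  · refine (Finset.card_union_union_le_four (card_common_le_two le_rfl hxy)
      (card_common_le_two le_rfl hxz) (card_common_le_two le_rfl hyz) ?_).trans (by norm_num)
    rcases (nbrs x ∩ nbrs y).eq_empty_or_nonempty with h | ⟨w₁, h₁⟩
    · exact .inl h
    rcases (nbrs x ∩ nbrs z).eq_empty_or_nonempty with h | ⟨w₂, h₂⟩
    · exact .inr (.inl h)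
    rcases (nbrs y ∩ nbrs z).eq_empty_or_nonempty with h | ⟨w₃, h₃⟩
    · exact .inr (.inr (.inl h))
    obtain ⟨t, hx, hy, hz⟩ := exists_common_of_four hxy hxz hyz h₁ h₂ h₃
    exact .inr (.inr (.inr ⟨t, Finset.mem_inter.2 ⟨hx, hy⟩, Finset.mem_inter.2 ⟨hx, hz⟩,
      Finset.mem_inter.2 ⟨hy, hz⟩⟩))
  · have hunion : (commonNbrs x y z).card ≤
        (nbrs x ∩ nbrs y).card + (nbrs x ∩ nbrs z).card + (nbrs y ∩ nbrs z).card :=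
      (Finset.card_union_le _ _).trans (Nat.add_le_add_right (Finset.card_union_le _ _) _)
    have h1 := card_common_le_two (by omega : 4 ≤ n) hxy
    have h2 := card_common_le_two (by omega : 4 ≤ n) hxz
    have h3 := card_common_le_two (by omega : 4 ≤ n) hyz
    omega

end BinString

/-! ### Families of subgraphs built from clusters; vertices in two or three clusters -/

namespace SimpleGraph

variable {V ι : Type*} {G : SimpleGraph V}

/-- Connected subgraphs containing `S` that meet only in `S`, no two of which share an edge
inside `S`. -/
structure IsTreeFamily (G : SimpleGraph V) (S : Set V) (H : ι → G.Subgraph) : Prop where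
  conn : ∀ i, (H i).Connected
  subset : ∀ i, S ⊆ (H i).verts
  inter : ∀ i j, i ≠ j → (H i).verts ∩ (H j).verts ⊆ S
  adj : ∀ i j, i ≠ j → ∀ u ∈ S, ∀ v ∈ S, (H i).Adj u v → ¬ (H j).Adj u v

theorem Subgraph.Connected.reflTransGen {H : G.Subgraph} (h : H.Connected) {u v : V}
    (hu : u ∈ H.verts) (hv : v ∈ H.verts) : Relation.ReflTransGen H.Adj u v := by
  have key : ∀ (u v : H.verts), H.coe.Walk u v → Relation.ReflTransGen H.Adj u.1 v.1 := by
    intro u v p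
    induction p with
    | nil => exact .refl
    | cons h _ ih => exact .head h ih
  obtain ⟨p⟩ := h.coe.preconnected ⟨u, hu⟩ ⟨v, hv⟩
  exact key _ _ p

/-- The edge from `p` to `a`, or the vertex `p` if `a = p`. -/
def star (G : SimpleGraph V) (p a : V) : G.Subgraph where
  verts := {p, a}
  Adj u v := G.Adj u v ∧ ((u = p ∧ v = a) ∨ (u = a ∧ v = p))
  adj_sub h := h.1
  edge_vert := by
    rintro u v ⟨_, ⟨rfl, _⟩ | ⟨rfl, _⟩⟩ <;> simp
  symm := ⟨by
    rintro u v ⟨h, h' | h'⟩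
    · exact ⟨h.symm, .inr h'.symm⟩
    · exact ⟨h.symm, .inl h'.symm⟩⟩

theorem star_connected {p a : V} (h : a = p ∨ G.Adj p a) : (G.star p a).Connected := by
  refine Subgraph.connected_of_root (r := p) (by simp [star]) ?_
  rintro w (rfl | rfl)
  · exact .refl
  · rcases h with rfl | h
    · exact .refl
    · exact .single ⟨h, .inl ⟨rfl, rfl⟩⟩

end SimpleGraph

namespace HFQ

open BinString SimpleGraph

variable {n : ℕ}

theorem adj_of_foldedCube {c p q : BinString n} (h : (foldedCube n).Adj p q) :
    (hierarchicalFoldedHypercube n).Adj (c, p) (c, q) := by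
  obtain ⟨hne, o, ho⟩ := h
  refine ⟨fun h => hne (Prod.ext_iff.1 h).2, ?_⟩
  rcases o with _ | i
  · refine .inr (.inl ⟨rfl, ?_⟩)
    rw [← compl_eq_symmDiff] at ho
    simp only [ho, BinString.compl_compl]
  · exact .inl ⟨rfl, hammingDist_eq_one_iff.2 ⟨i, ho⟩⟩

theorem adj_cross {c d : BinString n} (h : c ≠ d) :
    (hierarchicalFoldedHypercube n).Adj (c, d) (d, c) :=
  ⟨fun h' => h (Prod.ext_iff.1 h').1, .inr (.inr (.inr ⟨h, h, rfl, rfl⟩))⟩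

/-- A subgraph of the folded hypercube, placed in the cluster `c`. -/
def inCluster (c : BinString n) (Q : (foldedCube n).Subgraph) :
    (hierarchicalFoldedHypercube n).Subgraph where
  verts := {v | v.1 = c ∧ v.2 ∈ Q.verts}
  Adj u v := u.1 = c ∧ v.1 = c ∧ Q.Adj u.2 v.2
  adj_sub := by
    rintro ⟨_, p⟩ ⟨_, q⟩ ⟨rfl, rfl, h⟩
    exact adj_of_foldedCube h.adj_sub
  edge_vert h := ⟨h.1, h.2.2.fst_mem⟩
  symm := ⟨fun _ _ h => ⟨h.2.1, h.1, h.2.2.symm⟩⟩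

theorem inCluster_connected {c : BinString n} {Q : (foldedCube n).Subgraph} (h : Q.Connected) :
    (inCluster c Q).Connected := by
  obtain ⟨r, hr⟩ := h.nonempty
  refine Subgraph.connected_of_root (r := (c, r)) ⟨rfl, hr⟩ ?_
  rintro ⟨_, w⟩ ⟨rfl, hw⟩
  exact Relation.ReflTransGen.lift (fun p => (_, p)) (fun _ _ h => ⟨rfl, rfl, h⟩) _ _
    (h.reflTransGen hr hw)

/-- The clusters in `D` together with the vertices of the clusters in `C` leading to them; the
edges inside the clusters of `C` are left out. -/
def hub (C D : Set (BinString n)) : (hierarchicalFoldedHypercube n).Subgraph where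
  verts := {v | v.1 ∈ D ∨ (v.1 ∈ C ∧ v.2 ∈ D)}
  Adj u v := (hierarchicalFoldedHypercube n).Adj u v ∧ (u.1 ∈ D ∨ (u.1 ∈ C ∧ u.2 ∈ D)) ∧
    (v.1 ∈ D ∨ (v.1 ∈ C ∧ v.2 ∈ D)) ∧ ¬ (u.1 ∈ C ∧ v.1 ∈ C)
  adj_sub h := h.1
  edge_vert h := h.2.1
  symm := ⟨fun _ _ h => ⟨h.1.symm, h.2.2.1, h.2.1, fun h' => h.2.2.2 h'.symm⟩⟩

/-- Clusters in `D` are connected and pairwise joined by cross edges, and each exit `(c, p)` is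
adjacent to `(p, c)`. As `C` and `D` are disjoint, none of these edges lies inside `C`. -/
theorem hub_connected (hn : 3 ≤ n) {C D : Set (BinString n)} (hD : D.Nonempty)
    (hCD : Disjoint C D) : (hub C D).Connected := by
  obtain ⟨d, hd⟩ := hD
  have hC : ∀ e ∈ D, e ∉ C := fun e he h => Set.disjoint_left.1 hCD h he
  have hcl : ∀ e ∈ D, ∀ p q, Relation.ReflTransGen (hub C D).Adj (e, p) (e, q) := by
    intro e he p q
    have hJ := foldedCube_vertexConnected hn ∅ (by simp) p q (by simp) (by simp)
    refine Relation.ReflTransGen.lift (fun p => (e, p)) ?_ _ _ hJ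
    intro p q h
    exact ⟨adj_of_foldedCube h.1, .inl he, .inl he, fun h => hC e he h.1⟩
  have hto : ∀ e ∈ D, ∀ p, Relation.ReflTransGen (hub C D).Adj (d, d) (e, p) := by
    intro e he p
    by_cases hde : d = e
    · subst hde
      exact hcl d hd _ _
    · exact ((hcl d hd d e).tail ⟨adj_cross hde, .inl hd, .inl he, fun h => hC d hd h.1⟩).trans
        (hcl e he d p)
  refine Subgraph.connected_of_root (r := (d, d)) (.inl hd) ?_
  rintro ⟨c, p⟩ (h | ⟨hc, hp⟩)
  · exact hto c h p
  · have hpc : p ≠ c := fun h => hC p hp (h ▸ hc)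
    exact (hto p hp c).tail ⟨adj_cross hpc, .inl hp, .inr ⟨hc, hp⟩, fun h => hC p hp h.1⟩

/-- Subgraphs `L i` of the clusters in `C`, joined through disjoint sets of other clusters. -/
theorem isTreeFamily_hub {ι : Type*} {C : Set (BinString n)}
    {S : Set (BinString n × BinString n)} {D : ι → Set (BinString n)}
    {L : ι → (hierarchicalFoldedHypercube n).Subgraph} (hS : ∀ s ∈ S, s.1 ∈ C)
    (hD : ∀ i j, i ≠ j → Disjoint (D i) (D j)) (hCD : ∀ i, Disjoint C (D i))
    (hconn : ∀ i, (hub C (D i) ⊔ L i).Connected) (hSL : ∀ i, S ⊆ (L i).verts)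
    (hLC : ∀ i, ∀ v ∈ (L i).verts, v.1 ∈ C)
    (hLL : ∀ i j, i ≠ j → (L i).verts ∩ (L j).verts ⊆ S)
    (hLD : ∀ i j, i ≠ j → ∀ v ∈ (L i).verts, v.2 ∈ D j → v ∈ S)
    (hadj : ∀ i j, i ≠ j → ∀ u ∈ S, ∀ v ∈ S, (L i).Adj u v → ¬ (L j).Adj u v) :
    IsTreeFamily (hierarchicalFoldedHypercube n) S fun i => hub C (D i) ⊔ L i := by
  have hC : ∀ i, ∀ e ∈ D i, e ∉ C := fun i e he h => Set.disjoint_left.1 (hCD i) h he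
  refine ⟨hconn, fun i => (hSL i).trans Set.subset_union_right, ?_, ?_⟩
  · rintro i j hij v ⟨(h | ⟨hc, hp⟩) | h, (h' | ⟨hc', hp'⟩) | h'⟩
    · exact absurd h' (Set.disjoint_left.1 (hD i j hij) h)
    · exact absurd hc' (hC i _ h)
    · exact absurd (hLC j v h') (hC i _ h)
    · exact absurd hc (hC j _ h')
    · exact absurd hp' (Set.disjoint_left.1 (hD i j hij) hp)
    · exact hLD j i hij.symm v h' hp
    · exact absurd (hLC i v h) (hC j _ h')
    · exact hLD i j hij v h hp'
    · exact hLL i j hij ⟨h, h'⟩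
  · rintro i j hij u hu v hv (h | h) (h' | h')
    · exact h.2.2.2 ⟨hS u hu, hS v hv⟩
    · exact h.2.2.2 ⟨hS u hu, hS v hv⟩
    · exact h'.2.2.2 ⟨hS u hu, hS v hv⟩
    · exact hadj i j hij u hu v hv h h'

/-- Adding a connected piece of the cluster `c` to a connected subgraph that it meets. -/
theorem sup_inCluster_connected {H : (hierarchicalFoldedHypercube n).Subgraph}
    (hH : H.Connected) {c : BinString n} {Q : (foldedCube n).Subgraph} (hQ : Q.Connected)
    {p : BinString n} (h : (c, p) ∈ H.verts) (hp : p ∈ Q.verts) :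
    (H ⊔ inCluster c Q).Connected :=
  Subgraph.connected_sup hH.preconnected (inCluster_connected hQ).preconnected
    ⟨(c, p), h, rfl, hp⟩

/-- The `i`-th subgraph joins a path to exit `d i` in each of the three clusters through the cluster
`d i`. -/
theorem exists_family_three_clusters (hn : 3 ≤ n) {A B C : BinString n} (hAB : A ≠ B)
    (hAC : A ≠ C) (hBC : B ≠ C) (p q r : BinString n) :
    ∃ H : Fin (n + 1) → (hierarchicalFoldedHypercube n).Subgraph,
      IsTreeFamily _ {(A, p), (B, q), (C, r)} H := by
  obtain ⟨d, hd, hdA⟩ : ∃ d : Fin (n + 1) → BinString n, Function.Injective d ∧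
      ∀ i, d i ≠ A ∧ d i ≠ B ∧ d i ≠ C := by
    have h1 : ({A, B, C} : Finset (BinString n)).card ≤ 3 := Finset.card_le_three
    have h2 := Finset.card_compl ({A, B, C} : Finset (BinString n))
    -- Enough clusters for `n + 1` besides `A`, `B`, `C`.
    have hpow : n + 4 ≤ 2 ^ n := by
      obtain ⟨m, rfl⟩ : ∃ m, n = m + 3 := ⟨n - 3, by omega⟩
      have : m < 2 ^ m := Nat.lt_two_pow_self
      rw [pow_add]
      omega
    simp only [Fintype.card_pi, Fintype.card_bool, Finset.prod_const, Finset.card_univ,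
      Fintype.card_fin] at h2
    obtain ⟨D, hD, hDc⟩ := Finset.exists_subset_card_eq
      (show n + 1 ≤ ({A, B, C} : Finset (BinString n))ᶜ.card by omega)
    let e := (Finset.equivFinOfCardEq hDc).symm
    refine ⟨fun i => e i, fun i j h => e.injective (Subtype.ext h), fun i => ?_⟩
    have := hD (e i).2
    simpa [not_or] using this
  have hcard : (Finset.univ.image d).card ≤ n + 1 := by
    simpa using Finset.card_image_le (s := Finset.univ) (f := d)
  have hmem : ∀ i, d i ∈ Finset.univ.image d := fun i => Finset.mem_image_of_mem _ (by simp)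
  have hconn := foldedCube_vertexConnected hn
  obtain ⟨X, hX, hX'⟩ := hconn.exists_fan p _ hcard
  obtain ⟨Y, hY, hY'⟩ := hconn.exists_fan q _ hcard
  obtain ⟨Z, hZ, hZ'⟩ := hconn.exists_fan r _ hcard
  have hL : ∀ i v, v ∈ (inCluster A (X (d i)) ⊔ inCluster B (Y (d i)) ⊔
      inCluster C (Z (d i))).verts ↔ (v.1 = A ∧ v.2 ∈ (X (d i)).verts) ∨
      (v.1 = B ∧ v.2 ∈ (Y (d i)).verts) ∨ (v.1 = C ∧ v.2 ∈ (Z (d i)).verts) :=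
    fun i v => or_assoc
  refine ⟨_, isTreeFamily_hub (C := {A, B, C}) (D := fun i => {d i})
    (L := fun i => inCluster A (X (d i)) ⊔ inCluster B (Y (d i)) ⊔ inCluster C (Z (d i)))
    ?_ ?_ ?_ ?_ ?_ ?_ ?_ ?_ ?_⟩
  · rintro s (rfl | rfl | rfl) <;> simp
  · intro i j hij
    simpa using fun h => hij (hd h)
  · intro i
    simpa [not_or] using hdA i
  · intro i
    rw [← sup_assoc, ← sup_assoc]
    have h0 : (hub {A, B, C} {d i}).Connected :=
      hub_connected hn ⟨_, rfl⟩ (by simpa [not_or] using hdA i)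
    have h1 := sup_inCluster_connected (c := A) h0 (hX _ (hmem i)).1
      (.inr ⟨by simp, rfl⟩) (hX _ (hmem i)).2.2
    have h2 := sup_inCluster_connected (c := B) h1 (hY _ (hmem i)).1
      (.inl (.inr ⟨by simp, rfl⟩)) (hY _ (hmem i)).2.2
    exact sup_inCluster_connected (c := C) h2 (hZ _ (hmem i)).1
      (.inl (.inl (.inr ⟨by simp, rfl⟩))) (hZ _ (hmem i)).2.2
  · rintro i _ (rfl | rfl | rfl)
    · exact (hL i _).2 (.inl ⟨rfl, (hX _ (hmem i)).2.1⟩)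
    · exact (hL i _).2 (.inr (.inl ⟨rfl, (hY _ (hmem i)).2.1⟩))
    · exact (hL i _).2 (.inr (.inr ⟨rfl, (hZ _ (hmem i)).2.1⟩))
  · intro i v hv
    rcases (hL i v).1 hv with h | h | h <;> simp [h.1]
  · rintro i j hij v ⟨hi, hj⟩
    have hne : d i ≠ d j := fun h => hij (hd h)
    rcases (hL i _).1 hi with ⟨e, h⟩ | ⟨e, h⟩ | ⟨e, h⟩ <;>
      rcases (hL j _).1 hj with ⟨e', h'⟩ | ⟨e', h'⟩ | ⟨e', h'⟩
    · exact .inl (Prod.ext e (hX' _ (hmem i) _ (hmem j) hne ⟨h, h'⟩))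
    · exact absurd (e.symm.trans e') hAB
    · exact absurd (e.symm.trans e') hAC
    · exact absurd (e'.symm.trans e) hAB
    · exact .inr (.inl (Prod.ext e (hY' _ (hmem i) _ (hmem j) hne ⟨h, h'⟩)))
    · exact absurd (e.symm.trans e') hBC
    · exact absurd (e'.symm.trans e) hAC
    · exact absurd (e'.symm.trans e) hBC
    · exact .inr (.inr (Prod.ext e (hZ' _ (hmem i) _ (hmem j) hne ⟨h, h'⟩)))
  · rintro i j hij ⟨c, v⟩ hi rfl
    have hne : d i ≠ d j := fun h => hij (hd h)
    rcases (hL i _).1 hi with ⟨rfl, h⟩ | ⟨rfl, h⟩ | ⟨rfl, h⟩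
    · exact .inl (Prod.ext rfl (hX' _ (hmem i) _ (hmem j) hne ⟨h, (hX _ (hmem j)).2.2⟩))
    · exact .inr (.inl (Prod.ext rfl (hY' _ (hmem i) _ (hmem j) hne ⟨h, (hY _ (hmem j)).2.2⟩)))
    · exact .inr (.inr (Prod.ext rfl (hZ' _ (hmem i) _ (hmem j) hne ⟨h, (hZ _ (hmem j)).2.2⟩)))
  · have hS : ∀ u ∈ ({(A, p), (B, q), (C, r)} : Set (BinString n × BinString n)),
        ∀ v ∈ ({(A, p), (B, q), (C, r)} : Set (BinString n × BinString n)),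
        u.1 = v.1 → u = v := by
      rintro u (rfl | rfl | rfl) v (rfl | rfl | rfl) h
      · rfl
      · exact absurd h hAB
      · exact absurd h hAC
      · exact absurd h.symm hAB
      · rfl
      · exact absurd h hBC
      · exact absurd h.symm hAC
      · exact absurd h.symm hBC
      · rfl
    intro i j hij u hu v hv h
    refine absurd (hS u hu v hv ?_) h.ne
    rcases h with (h | h) | h <;> exact h.1.trans h.2.1.symm

/-- The `i`-th subgraph is a connection `Q i` of `p` and `q` inside `A`, left through its
representative `u i`, and a fan path from `r` inside `B`. The representatives avoid `A`, because
position `A` of cluster `A` leads to no cluster by the exchange rule. -/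
theorem exists_family_two_clusters (hn : 3 ≤ n) {A B : BinString n} (hAB : A ≠ B)
    {p q : BinString n} (hpq : p ≠ q) (r : BinString n) :
    ∃ H : Fin (n + 1) → (hierarchicalFoldedHypercube n).Subgraph,
      IsTreeFamily _ {(A, p), (A, q), (B, r)} H := by
  have hconn := foldedCube_vertexConnected hn
  have hpow : n + 1 < Fintype.card (BinString n) := by
    obtain ⟨m, rfl⟩ : ∃ m, n = m + 3 := ⟨n - 3, by omega⟩
    have : m < 2 ^ m := Nat.lt_two_pow_self
    simp only [Fintype.card_pi, Fintype.card_bool, Finset.prod_const, Finset.card_univ,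
      Fintype.card_fin, pow_add]
    omega
  obtain ⟨Q, u, hQ, hu, huA, hQQ, hQadj⟩ := hconn.exists_connections hpow hpq A
  -- the exit of the `i`-th tree from the cluster `B`
  let t : Fin (n + 1) → BinString n := fun i => if u i = B then A else u i
  have htB : ∀ i, u i = B → t i = A := fun i h => if_pos h
  have htu : ∀ i, u i ≠ B → t i = u i := fun i h => if_neg h
  have ht : Function.Injective t := by
    intro i j hij
    by_cases hi : u i = B <;> by_cases hj : u j = B
    · exact hu (hi.trans hj.symm)
    · rw [htB i hi, htu j hj] at hij
      exact absurd hij.symm (huA j)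
    · rw [htu i hi, htB j hj] at hij
      exact absurd hij (huA i)
    · rw [htu i hi, htu j hj] at hij
      exact hu hij
  have hcard : (Finset.univ.image t).card ≤ n + 1 := by
    simpa using Finset.card_image_le (s := Finset.univ) (f := t)
  have hmem : ∀ i, t i ∈ Finset.univ.image t := fun i => Finset.mem_image_of_mem _ (by simp)
  obtain ⟨F, hF, hF'⟩ := hconn.exists_fan r _ hcard
  have hFF : ∀ i j, i ≠ j → ∀ v, v ∈ (F (t i)).verts → v ∈ (F (t j)).verts → v = r :=
    fun i j hij v h h' => hF' _ (hmem i) _ (hmem j) (fun h => hij (ht h)) ⟨h, h'⟩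
  have hQS : ∀ i j, i ≠ j → ∀ v, v ∈ (Q i).verts → v ∈ (Q j).verts →
      (A, v) ∈ ({(A, p), (A, q), (B, r)} : Set (BinString n × BinString n)) := by
    intro i j hij v h h'
    rcases hQQ i j hij ⟨h, h'⟩ with rfl | rfl <;> simp
  -- A connection whose exit is `B` needs no outside cluster: the edge from `(A, B)` to `(B, A)`,
  -- which is `K i`, links it directly to the fan path ending at `A`.
  let D : Fin (n + 1) → Set (BinString n) := fun i => {d | d = u i ∧ u i ≠ B}
  let K : Fin (n + 1) → (hierarchicalFoldedHypercube n).Subgraph := fun i =>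
    if u i = B then subgraphOfAdj _ (adj_cross hAB) else ⊥
  have hKB : ∀ i, u i = B → K i = subgraphOfAdj _ (adj_cross hAB) := fun i h => if_pos h
  have hK : ∀ i, u i ≠ B → K i = ⊥ := fun i h => if_neg h
  have hKv : ∀ i, ∀ v ∈ (K i).verts,
      (v.1 = A ∧ v.2 ∈ (Q i).verts) ∨ (v.1 = B ∧ v.2 ∈ (F (t i)).verts) := by
    intro i v hv
    by_cases hi : u i = B
    · rw [hKB i hi] at hv
      rcases hv with rfl | rfl
      · exact .inl ⟨rfl, hi ▸ (hQ i).2.2.2⟩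
      · exact .inr ⟨rfl, htB i hi ▸ (hF _ (hmem i)).2.2⟩
    · rw [hK i hi] at hv
      exact absurd hv (Set.notMem_empty _)
  have hL : ∀ i v, v ∈ (inCluster A (Q i) ⊔ inCluster B (F (t i)) ⊔ K i).verts →
      (v.1 = A ∧ v.2 ∈ (Q i).verts) ∨ (v.1 = B ∧ v.2 ∈ (F (t i)).verts) := by
    rintro i v ((h | h) | h)
    · exact .inl h
    · exact .inr h
    · exact hKv i v h
  have hKadj : ∀ i v w, (K i).Adj v w → u i = B ∧ v.1 ≠ w.1 := by
    intro i v w h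
    by_cases hi : u i = B
    · refine ⟨hi, ?_⟩
      rw [hKB i hi, subgraphOfAdj_adj, Sym2.eq_iff] at h
      rcases h with ⟨rfl, rfl⟩ | ⟨rfl, rfl⟩
      · exact hAB
      · exact hAB.symm
    · rw [hK i hi] at h
      exact h.elim
  refine ⟨_, isTreeFamily_hub (C := {A, B}) (D := D)
    (L := fun i => inCluster A (Q i) ⊔ inCluster B (F (t i)) ⊔ K i) ?_ ?_ ?_ ?_ ?_ ?_ ?_ ?_ ?_⟩
  · rintro s (rfl | rfl | rfl) <;> simp
  · intro i j hij
    rw [Set.disjoint_left]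
    rintro d ⟨rfl, _⟩ ⟨h, _⟩
    exact hij (hu h)
  · intro i
    rw [Set.disjoint_right]
    rintro d ⟨rfl, h⟩ (h' | h')
    · exact huA i h'
    · exact h h'
  · intro i
    by_cases hi : u i = B
    · have hD : hub {A, B} (D i) = ⊥ := by
        have hDe : D i = ∅ := by
          ext d
          simp [D, hi]
        ext <;> simp [hub, hDe]
      rw [hD, bot_sup_eq, sup_right_comm, hKB i hi]
      refine sup_inCluster_connected (p := A) (Subgraph.connected_sup
        (inCluster_connected (hQ i).1).preconnected
        (Subgraph.subgraphOfAdj_connected _).preconnected ?_) (hF _ (hmem i)).1 ?_ ?_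
      · exact ⟨(A, B), ⟨rfl, hi ▸ (hQ i).2.2.2⟩, .inl rfl⟩
      · exact .inr (.inr rfl)
      · exact htB i hi ▸ (hF _ (hmem i)).2.2
    · rw [hK i hi, sup_bot_eq, ← sup_assoc]
      have hCD : Disjoint ({A, B} : Set (BinString n)) (D i) := by
        rw [Set.disjoint_right]
        rintro d ⟨rfl, h⟩ (h' | h')
        · exact huA i h'
        · exact h h'
      have h0 : (hub {A, B} (D i)).Connected := hub_connected hn ⟨u i, rfl, hi⟩ hCD
      have h1 := sup_inCluster_connected (c := A) (p := u i) h0 (hQ i).1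
        (.inr ⟨by simp, rfl, hi⟩) (hQ i).2.2.2
      exact sup_inCluster_connected (c := B) (p := t i) h1 (hF _ (hmem i)).1
        (.inl (.inr ⟨by simp, htu i hi, hi⟩)) (hF _ (hmem i)).2.2
  · rintro i _ (rfl | rfl | rfl)
    · exact .inl (.inl ⟨rfl, (hQ i).2.1⟩)
    · exact .inl (.inl ⟨rfl, (hQ i).2.2.1⟩)
    · exact .inl (.inr ⟨rfl, (hF _ (hmem i)).2.1⟩)
  · intro i v hv
    rcases hL i v hv with h | h
    · exact .inl h.1
    · exact .inr h.1
  · rintro i j hij ⟨c, v⟩ ⟨hi, hj⟩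
    rcases hL i _ hi with ⟨e, h⟩ | ⟨e, h⟩ <;> rcases hL j _ hj with ⟨e', h'⟩ | ⟨e', h'⟩
    · obtain rfl : c = A := e
      exact hQS i j hij v h h'
    · exact absurd (e.symm.trans e') hAB
    · exact absurd (e'.symm.trans e) hAB
    · exact .inr (.inr (Prod.ext e (hFF i j hij v h h')))
  · rintro i j hij ⟨c, v⟩ hi ⟨hv, hj⟩
    obtain rfl : v = u j := hv
    rcases hL i _ hi with ⟨e, h⟩ | ⟨e, h⟩
    · obtain rfl : c = A := e
      exact hQS i j hij _ h (hQ j).2.2.2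
    · refine .inr (.inr (Prod.ext e (hFF i j hij _ h ?_)))
      rw [← htu j hj]
      exact (hF _ (hmem j)).2.2
  · -- edges inside `S`
    have hfan : ∀ i, ∀ v ∈ ({(A, p), (A, q), (B, r)} : Set (BinString n × BinString n)),
        ∀ w ∈ ({(A, p), (A, q), (B, r)} : Set (BinString n × BinString n)),
        ¬ (inCluster B (F (t i))).Adj v w := by
      rintro i v (rfl | rfl | rfl) w (rfl | rfl | rfl) ⟨h1, h2, h3⟩
      all_goals first
        | exact absurd h1 hAB
        | exact absurd h2 hAB
        | exact h3.ne rfl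
    have hpath : ∀ i, ∀ v ∈ ({(A, p), (A, q), (B, r)} : Set (BinString n × BinString n)),
        ∀ w ∈ ({(A, p), (A, q), (B, r)} : Set (BinString n × BinString n)),
        (inCluster A (Q i)).Adj v w → (Q i).Adj p q := by
      rintro i v (rfl | rfl | rfl) w (rfl | rfl | rfl) ⟨h1, h2, h3⟩
      all_goals first
        | exact absurd h1.symm hAB
        | exact absurd h2.symm hAB
        | exact absurd rfl h3.ne
        | exact h3
        | exact h3.symm
    rintro i j hij v hv w hw ((h | h) | h) ((h' | h') | h')
    · exact hQadj i j hij (hpath i v hv w hw h) (hpath j v hv w hw h')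
    · exact hfan j v hv w hw h'
    · exact (hKadj j v w h').2 (h.1.trans h.2.1.symm)
    · exact hfan i v hv w hw h
    · exact hfan i v hv w hw h
    · exact hfan i v hv w hw h
    · exact (hKadj i v w h).2 (h'.1.trans h'.2.1.symm)
    · exact hfan j v hv w hw h'
    · exact hij (hu ((hKadj i v w h).1.trans (hKadj j v w h').1.symm))

end HFQ

/-! ### Three vertices in one cluster -/

/-- An enumeration of `X` in which the elements of `U` have prescribed places. -/
theorem Finset.exists_enumeration {α : Type*} [DecidableEq α] {m : ℕ} {X U : Finset α}
    (hX : X.card = m) {g : α → Fin m} (hg : Set.InjOn g U) :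
    ∃ a : Fin m → α, Function.Injective a ∧ (∀ i, a i ∈ X) ∧ ∀ i, a i ∈ U → g (a i) = i := by
  obtain ⟨e, he⟩ := Finset.exists_equiv_extend_of_card_eq (α := X)
    (t := (Finset.univ : Finset (Fin m)))
    (by simpa using hX) (s := Finset.univ.filter fun x : X => x.1 ∈ U) (f := fun x => g x.1)
    (by simp) (by
      intro x hx y hy h
      simp only [Finset.coe_filter, Finset.mem_univ, true_and, Set.mem_ofPred_eq] at hx hy
      exact Subtype.ext (hg hx hy h))
  refine ⟨fun i => e.symm ⟨i, Finset.mem_univ _⟩, fun i j h => ?_, fun i => (e.symm _).2, ?_⟩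
  · have := e.symm.injective (Subtype.ext h)
    simpa using this
  · intro i hi
    have := he (e.symm ⟨i, Finset.mem_univ _⟩) (by simpa using hi)
    simpa using this.symm

namespace HFQ

open BinString SimpleGraph

variable {n : ℕ}

/-- Trees for three vertices of one cluster: the `i`-th tree leaves the cluster through `a i`,
`b i` and `c i`; the vertex `q` may be attached to `p` or `r` instead. -/
theorem isTreeFamily_of_exits (hn : 3 ≤ n) {A p q r : BinString n} {m : ℕ}
    {a b c : Fin m → BinString n} (ha : Function.Injective a) (hb : Function.Injective b)
    (hc : Function.Injective c)
    (hpa : ∀ i, a i = p ∨ (foldedCube n).Adj p (a i))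
    (hqb : ∀ i, b i = q ∨ (foldedCube n).Adj q (b i))
    (hrc : ∀ i, c i = r ∨ (foldedCube n).Adj r (c i))
    (haA : ∀ i, a i ≠ A ∧ a i ≠ q ∧ a i ≠ r) (hbA : ∀ i, b i ≠ A)
    (hcA : ∀ i, c i ≠ A ∧ c i ≠ p ∧ c i ≠ q)
    (hab : ∀ i j, a i = b j → i = j ∨ b j = p) (hac : ∀ i j, a i = c j → i = j)
    (hcb : ∀ i j, c i = b j → i = j ∨ b j = r) :
    ∃ H : Fin m → (hierarchicalFoldedHypercube n).Subgraph,
      IsTreeFamily _ {(A, p), (A, q), (A, r)} H ∧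
      ((∀ i, b i ≠ p ∧ b i ≠ r) →
        ∀ i, ∀ u ∈ ({(A, p), (A, q), (A, r)} : Set (BinString n × BinString n)),
        ∀ v ∈ ({(A, p), (A, q), (A, r)} : Set (BinString n × BinString n)), ¬ (H i).Adj u v) := by
  -- If `b i` is `p` or `r`, then `q` is attached there by an edge inside `S`. Cluster `b i` is then
  -- left out, because another tree may own it as an exit of `p` or `r` itself.
  let D : Fin m → Set (BinString n) := fun i =>
    {w | w = a i ∨ w = c i ∨ (w = b i ∧ b i ≠ p ∧ b i ≠ r)}
  let L : Fin m → (hierarchicalFoldedHypercube n).Subgraph := fun i =>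
    inCluster A ((foldedCube n).star p (a i)) ⊔ inCluster A ((foldedCube n).star r (c i)) ⊔
      inCluster A ((foldedCube n).star q (b i))
  have hSmem : ∀ v : BinString n × BinString n,
      v ∈ ({(A, p), (A, q), (A, r)} : Set (BinString n × BinString n)) →
      v.1 = A ∧ (v.2 = p ∨ v.2 = q ∨ v.2 = r) := by
    rintro v (rfl | rfl | rfl) <;> simp
  have hmemS : ∀ v : BinString n × BinString n, v.1 = A → (v.2 = p ∨ v.2 = q ∨ v.2 = r) →
      v ∈ ({(A, p), (A, q), (A, r)} : Set (BinString n × BinString n)) := by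
    rintro ⟨_, v⟩ rfl (rfl | rfl | rfl) <;> simp
  have hL : ∀ i, ∀ v ∈ (L i).verts, v.1 = A ∧
      ((v.2 = p ∨ v.2 = q ∨ v.2 = r) ∨ v.2 = a i ∨ v.2 = c i ∨ v.2 = b i) := by
    rintro i v ((⟨h, h' | h'⟩ | ⟨h, h' | h'⟩) | ⟨h, h' | h'⟩)
    · exact ⟨h, .inl (.inl h')⟩
    · exact ⟨h, .inr (.inl h')⟩
    · exact ⟨h, .inl (.inr (.inr h'))⟩
    · exact ⟨h, .inr (.inr (.inl h'))⟩
    · exact ⟨h, .inl (.inr (.inl h'))⟩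
    · exact ⟨h, .inr (.inr (.inr h'))⟩
  have hDD : ∀ i j, ∀ w ∈ D i, w ∈ D j → i = j := by
    rintro i j w (h | h | ⟨h, hp, hr⟩) (h' | h' | ⟨h', hp', hr'⟩)
    · exact ha (h.symm.trans h')
    · exact hac i j (h.symm.trans h')
    · exact (hab i j (h.symm.trans h')).resolve_right hp'
    · exact (hac j i (h'.symm.trans h)).symm
    · exact hc (h.symm.trans h')
    · exact (hcb i j (h.symm.trans h')).resolve_right hr'
    · exact ((hab j i (h'.symm.trans h)).resolve_right hp).symm
    · exact ((hcb j i (h'.symm.trans h)).resolve_right hr).symm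
    · exact hb (h.symm.trans h')
  have hmem : ∀ i, ∀ w, w = a i ∨ w = c i ∨ w = b i → w ∈ D i ∨ (w = p ∨ w = q ∨ w = r) := by
    rintro i w (h | h | h)
    · exact .inl (.inl h)
    · exact .inl (.inr (.inl h))
    · by_cases hp : b i = p
      · exact .inr (.inl (h.trans hp))
      · by_cases hr : b i = r
        · exact .inr (.inr (.inr (h.trans hr)))
        · exact .inl (.inr (.inr ⟨h, hp, hr⟩))
  have hDA : ∀ i, Disjoint ({A} : Set (BinString n)) (D i) := by
    intro i
    rw [Set.disjoint_singleton_left]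
    rintro (h | h | ⟨h, -⟩)
    · exact (haA i).1 h.symm
    · exact (hcA i).1 h.symm
    · exact hbA i h.symm
  have hLadj : ∀ i, ∀ u ∈ ({(A, p), (A, q), (A, r)} : Set (BinString n × BinString n)),
      ∀ v ∈ ({(A, p), (A, q), (A, r)} : Set (BinString n × BinString n)), (L i).Adj u v →
      (b i = p ∨ b i = r) ∧ ((u.2 = q ∧ v.2 = b i) ∨ (u.2 = b i ∧ v.2 = q)) := by
    have hX : ∀ i w, w = a i → (w = p ∨ w = q ∨ w = r) → w = p := by
      rintro i w rfl (h | h | h)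
      · exact h
      · exact absurd h (haA i).2.1
      · exact absurd h (haA i).2.2
    have hZ : ∀ i w, w = c i → (w = p ∨ w = q ∨ w = r) → w = r := by
      rintro i w rfl (h | h | h)
      · exact absurd h (hcA i).2.1
      · exact absurd h (hcA i).2.2
      · exact h
    have hY : ∀ i u w, (foldedCube n).Adj u w → u = q → w = b i → (w = p ∨ w = q ∨ w = r) →
        b i = p ∨ b i = r := by
      rintro i u w hne rfl rfl (h | h | h)
      · exact .inl h
      · exact absurd h.symm hne.ne
      · exact .inr h
    intro i u hu v hv h
    have hu := (hSmem u hu).2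
    have hv := (hSmem v hv).2
    rcases h with (⟨-, -, h, h' | h'⟩ | ⟨-, -, h, h' | h'⟩) | ⟨-, -, h, h' | h'⟩
    · exact absurd (h'.1.trans (hX i _ h'.2 hv).symm) h.ne
    · exact absurd ((hX i _ h'.1 hu).trans h'.2.symm) h.ne
    · exact absurd (h'.1.trans (hZ i _ h'.2 hv).symm) h.ne
    · exact absurd ((hZ i _ h'.1 hu).trans h'.2.symm) h.ne
    · exact ⟨hY i _ _ h h'.1 h'.2 hv, .inl h'⟩
    · exact ⟨hY i _ _ h.symm h'.2 h'.1 hu, .inr h'⟩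
  refine ⟨fun i => hub {A} (D i) ⊔ L i, isTreeFamily_hub ?_ ?_ hDA ?_ ?_ ?_ ?_ ?_ ?_, ?_⟩
  · exact fun s hs => (hSmem s hs).1
  · exact fun i j hij => Set.disjoint_left.2 fun w h h' => hij (hDD i j w h h')
  · intro i
    rw [← sup_assoc, ← sup_assoc]
    have h0 : (hub {A} (D i)).Connected := hub_connected hn ⟨a i, .inl rfl⟩ (hDA i)
    have h1 := sup_inCluster_connected (c := A) (p := a i) h0 (star_connected (hpa i))
      (.inr ⟨rfl, .inl rfl⟩) (.inr rfl)
    have h2 := sup_inCluster_connected (c := A) (p := c i) h1 (star_connected (hrc i))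
      (.inl (.inr ⟨rfl, .inr (.inl rfl)⟩)) (.inr rfl)
    refine sup_inCluster_connected (c := A) (p := b i) h2 (star_connected (hqb i)) ?_ (.inr rfl)
    by_cases hp : b i = p
    · exact .inl (.inr ⟨rfl, .inl hp⟩)
    · by_cases hr : b i = r
      · exact .inr ⟨rfl, .inl hr⟩
      · exact .inl (.inl (.inr ⟨rfl, .inr (.inr ⟨rfl, hp, hr⟩)⟩))
  · rintro i _ (rfl | rfl | rfl)
    · exact .inl (.inl ⟨rfl, .inl rfl⟩)
    · exact .inr ⟨rfl, .inl rfl⟩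
    · exact .inl (.inr ⟨rfl, .inl rfl⟩)
  · exact fun i v hv => (hL i v hv).1
  · rintro i j hij v ⟨hi, hj⟩
    obtain ⟨hvA, hi⟩ := hL i v hi
    obtain ⟨-, hj⟩ := hL j v hj
    refine hmemS v hvA ?_
    rcases hi with hi | hi
    · exact hi
    rcases hj with hj | hj
    · exact hj
    rcases hmem i _ hi with hi | hi
    · rcases hmem j _ hj with hj | hj
      · exact absurd (hDD i j _ hi hj) hij
      · exact hj
    · exact hi
  · intro i j hij v hi hj
    obtain ⟨hvA, hi⟩ := hL i v hi
    refine hmemS v hvA ?_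
    rcases hi with hi | hi
    · exact hi
    rcases hmem i _ hi with hi | hi
    · exact absurd (hDD i j _ hi hj) hij
    · exact hi
  · intro i j hij u hu v hv h h'
    obtain ⟨hi, h⟩ := hLadj i u hu v hv h
    obtain ⟨hj, h'⟩ := hLadj j u hu v hv h'
    refine hij (hb ?_)
    rcases h with ⟨h1, h2⟩ | ⟨h1, h2⟩ <;> rcases h' with ⟨h3, h4⟩ | ⟨h3, h4⟩
    · exact h2.symm.trans h4
    · rw [← h2, h4, ← h3, h1]
    · rw [← h1, h3, ← h4, h2]
    · exact h1.symm.trans h3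
  · rintro hbS i u hu v hv (h | h)
    · exact h.2.2.2 ⟨(hSmem u hu).1, (hSmem v hv).1⟩
    · exact (hLadj i u hu v hv h).1.elim (hbS i).1 (hbS i).2

/-- The exits may be chosen from sets of `m` vertices in which few vertices are repeated. -/
theorem isTreeFamily_of_exit_sets (hn : 3 ≤ n) {A p q r : BinString n} {m : ℕ} (hm : 0 < m)
    {X Y Z : Finset (BinString n)} (hX : X.card = m) (hY : Y.card = m) (hZ : Z.card = m)
    (hpX : ∀ v ∈ X, (v = p ∨ v ∈ nbrs p) ∧ v ≠ A ∧ v ≠ q ∧ v ≠ r)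
    (hqY : ∀ v ∈ Y, (v = q ∨ v ∈ nbrs q) ∧ v ≠ A)
    (hrZ : ∀ v ∈ Z, (v = r ∨ v ∈ nbrs r) ∧ v ≠ A ∧ v ≠ p ∧ v ≠ q)
    (hU : (((X ∩ Y ∪ X ∩ Z ∪ Y ∩ Z).erase p).erase r).card ≤ m) :
    ∃ H : Fin m → (hierarchicalFoldedHypercube n).Subgraph,
      IsTreeFamily _ {(A, p), (A, q), (A, r)} H ∧
      ((∀ v ∈ Y, v ≠ p ∧ v ≠ r) →
        ∀ i, ∀ u ∈ ({(A, p), (A, q), (A, r)} : Set (BinString n × BinString n)),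
        ∀ v ∈ ({(A, p), (A, q), (A, r)} : Set (BinString n × BinString n)), ¬ (H i).Adj u v) := by
  set U := ((X ∩ Y ∪ X ∩ Z ∪ Y ∩ Z).erase p).erase r with hUdef
  -- An injective assignment of the repeated exits to trees. All three enumerations respect it, so a
  -- position shared by two vertices of `S` gets the same index in both.
  obtain ⟨g, hg⟩ : ∃ g : BinString n → Fin m, Set.InjOn g U := by
    have hcard : Fintype.card U ≤ Fintype.card (Fin m) := by simpa using hU
    obtain ⟨f⟩ := Function.Embedding.nonempty_of_card_le hcard
    refine ⟨fun v => if h : v ∈ U then f ⟨v, h⟩ else ⟨0, hm⟩, fun v hv w hw h => ?_⟩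
    simp only [Finset.mem_coe.1 hv, Finset.mem_coe.1 hw, dif_pos] at h
    simpa using f.injective h
  obtain ⟨a, ha, haX, haU⟩ := Finset.exists_enumeration hX hg
  obtain ⟨b, hb, hbY, hbU⟩ := Finset.exists_enumeration hY hg
  obtain ⟨c, hc, hcZ, hcU⟩ := Finset.exists_enumeration hZ hg
  have hadj : ∀ {u v : BinString n}, v = u ∨ v ∈ nbrs u → v = u ∨ (foldedCube n).Adj u v :=
    fun h => h.imp id (foldedCube_adj_iff_mem_nbrs (by omega)).2
  have hmemU : ∀ v, v ≠ p → v ≠ r → (v ∈ X ∧ v ∈ Y ∨ v ∈ X ∧ v ∈ Z ∨ v ∈ Y ∧ v ∈ Z) → v ∈ U := by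
    intro v hp hr h
    simp only [hUdef, Finset.mem_erase, Finset.mem_union, Finset.mem_inter]
    tauto
  have hab : ∀ i j, a i = b j → i = j ∨ b j = p := by
    intro i j h
    by_cases hp : b j = p
    · exact .inr hp
    · have hr : b j ≠ r := h ▸ (hpX _ (haX i)).2.2.2
      have hm := hmemU (b j) hp hr (.inl ⟨h ▸ haX i, hbY j⟩)
      exact .inl ((haU i (h ▸ hm)).symm.trans ((congrArg g h).trans (hbU j hm)))
  have hac : ∀ i j, a i = c j → i = j := by
    intro i j h
    have hp : c j ≠ p := (hrZ _ (hcZ j)).2.2.1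
    have hr : c j ≠ r := h ▸ (hpX _ (haX i)).2.2.2
    have hm := hmemU (c j) hp hr (.inr (.inl ⟨h ▸ haX i, hcZ j⟩))
    exact (haU i (h ▸ hm)).symm.trans ((congrArg g h).trans (hcU j hm))
  have hcb : ∀ i j, c i = b j → i = j ∨ b j = r := by
    intro i j h
    by_cases hr : b j = r
    · exact .inr hr
    · have hp : b j ≠ p := h ▸ (hrZ _ (hcZ i)).2.2.1
      have hm := hmemU (b j) hp hr (.inr (.inr ⟨hbY j, h ▸ hcZ i⟩))
      exact .inl ((hcU i (h ▸ hm)).symm.trans ((congrArg g h).trans (hbU j hm)))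
  obtain ⟨H, hH, hH'⟩ := isTreeFamily_of_exits hn (A := A) (p := p) (q := q) (r := r) ha hb hc
    (fun i => hadj (hpX _ (haX i)).1) (fun i => hadj (hqY _ (hbY i)).1)
    (fun i => hadj (hrZ _ (hcZ i)).1) (fun i => (hpX _ (haX i)).2) (fun i => (hqY _ (hbY i)).2)
    (fun i => (hrZ _ (hcZ i)).2) hab hac hcb
  exact ⟨H, hH, fun h => hH' fun i => h _ (hbY i)⟩

theorem card_insert_nbrs (hn : 2 ≤ n) (p : BinString n) : (insert p (nbrs p)).card = n + 2 := by
  rw [Finset.card_insert_of_notMem (not_mem_nbrs_self (by omega) p), card_nbrs hn]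

/-- `p` has `n + 1` exits other than `A`, `q` and `r`, unless both `q` and `A` obstruct it. -/
theorem le_card_exits (hn : 2 ≤ n) {A p q r : BinString n} (hpq : p ≠ q) (hpr : p ≠ r)
    (hr : r ∉ nbrs p) (h : q ∈ nbrs p → A ≠ q → A ∉ insert p (nbrs p)) :
    n + 1 ≤ ((((insert p (nbrs p)).erase q).erase r).erase A).card := by
  have hc := card_insert_nbrs hn p
  have hr' : r ∉ (insert p (nbrs p)).erase q := by
    simp [hr, hpr.symm]
  rw [Finset.erase_eq_of_notMem hr']
  by_cases hq : q ∈ nbrs p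
  · have hcq := Finset.card_erase_of_mem (Finset.mem_insert_of_mem hq : q ∈ insert p (nbrs p))
    have hA : A ∉ (insert p (nbrs p)).erase q := by
      rw [Finset.mem_erase]
      exact fun h' => h hq h'.1 h'.2
    rw [Finset.erase_eq_of_notMem hA]
    omega
  · have hq' : q ∉ insert p (nbrs p) := by simp [hq, hpq.symm]
    rw [Finset.erase_eq_of_notMem hq']
    have := Finset.pred_card_le_card_erase (s := insert p (nbrs p)) (a := A)
    omega

/-- The exits of `q` may include `p` and `r`, but not conversely, so edges inside `S` all start at
`q`. Apart from `p` and `r`, a repeated exit is adjacent to two of the three vertices, and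
`card_commonNbrs_le` bounds their number. -/
theorem exists_family_of_exits (hn : 3 ≤ n) {A p q r : BinString n} (hpq : p ≠ q) (hpr : p ≠ r)
    (hqr : q ≠ r) (hr : r ∉ nbrs p) (hp' : q ∈ nbrs p → A ≠ q → A ∉ insert p (nbrs p))
    (hr' : q ∈ nbrs r → A ≠ q → A ∉ insert r (nbrs r)) :
    ∃ H : Fin (n + 1) → (hierarchicalFoldedHypercube n).Subgraph,
      IsTreeFamily _ {(A, p), (A, q), (A, r)} H := by
  have hrp : p ∉ nbrs r := fun h => hr (mem_nbrs_comm.1 h)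
  obtain ⟨X, hX, hXc⟩ := Finset.exists_subset_card_eq (le_card_exits (by omega) hpq hpr hr hp')
  obtain ⟨Z, hZ, hZc⟩ := Finset.exists_subset_card_eq
    (le_card_exits (by omega) hqr.symm hpr.symm hrp hr')
  have hY0 : n + 1 ≤ ((insert q (nbrs q)).erase A).card := by
    have := Finset.pred_card_le_card_erase (s := insert q (nbrs q)) (a := A)
    rw [card_insert_nbrs (by omega)] at this
    omega
  obtain ⟨Y, hY, hYc⟩ := Finset.exists_subset_card_eq hY0
  have hX' : ∀ v ∈ X, (v = p ∨ v ∈ nbrs p) ∧ v ≠ A ∧ v ≠ q ∧ v ≠ r := by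
    intro v hv
    have := hX hv
    simp only [Finset.mem_erase, Finset.mem_insert] at this
    exact ⟨this.2.2.2, this.1, this.2.2.1, this.2.1⟩
  have hY' : ∀ v ∈ Y, (v = q ∨ v ∈ nbrs q) ∧ v ≠ A := by
    intro v hv
    have := hY hv
    simp only [Finset.mem_erase, Finset.mem_insert] at this
    exact ⟨this.2, this.1⟩
  have hZ' : ∀ v ∈ Z, (v = r ∨ v ∈ nbrs r) ∧ v ≠ A ∧ v ≠ p ∧ v ≠ q := by
    intro v hv
    have := hZ hv
    simp only [Finset.mem_erase, Finset.mem_insert] at this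
    exact ⟨this.2.2.2, this.1, this.2.1, this.2.2.1⟩
  have hsub : ((X ∩ Y ∪ X ∩ Z ∪ Y ∩ Z).erase p).erase r ⊆ commonNbrs p q r := by
    intro v hv
    simp only [commonNbrs, Finset.mem_erase, Finset.mem_union, Finset.mem_inter] at hv ⊢
    rcases hv with ⟨hvr, hvp, (⟨h, h'⟩ | ⟨h, h'⟩) | ⟨h, h'⟩⟩
    · obtain ⟨h1, -, hq, -⟩ := hX' v h
      exact .inl (.inl ⟨h1.resolve_left hvp, (hY' v h').1.resolve_left hq⟩)
    · exact .inl (.inr ⟨(hX' v h).1.resolve_left hvp, (hZ' v h').1.resolve_left hvr⟩)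
    · obtain ⟨h1, -, -, hq⟩ := hZ' v h'
      exact .inr ⟨(hY' v h).1.resolve_left hq, h1.resolve_left hvr⟩
  obtain ⟨H, hH, -⟩ := isTreeFamily_of_exit_sets hn (by omega) hXc hYc hZc hX' hY' hZ'
    ((Finset.card_le_card hsub).trans (card_commonNbrs_le hn hpq hpr hqr))
  exact ⟨H, hH⟩

/-- The path `p`, `q`, `r` is one of the trees, so only `n` exits are needed at each vertex. The
exits of `q` are its closed neighbourhood without `p` and `r`, which has exactly `n` elements and by
hypothesis does not contain `A`. -/
theorem exists_family_of_path (hn : 3 ≤ n) {A p q r : BinString n} (hpq : p ≠ q) (hpr : p ≠ r)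
    (hqr : q ≠ r) (hqp : q ∈ nbrs p) (hqr' : q ∈ nbrs r)
    (hA : A ∈ insert q (nbrs q) → A = p ∨ A = r) :
    ∃ H : Fin (n + 1) → (hierarchicalFoldedHypercube n).Subgraph,
      IsTreeFamily _ {(A, p), (A, q), (A, r)} H := by
  have hpq' := mem_nbrs_comm.1 hqp
  have hrq' := mem_nbrs_comm.1 hqr'
  have hr : r ∉ nbrs p := fun h => triangle_free hn hqp hrq' h
  have hp : p ∉ nbrs r := fun h => hr (mem_nbrs_comm.1 h)
  have hcard : ∀ {p : BinString n}, q ∈ nbrs p →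
      n ≤ (((insert p (nbrs p)).erase q).erase A).card := by
    intro p hq
    have h1 := Finset.card_erase_of_mem (Finset.mem_insert_of_mem hq : q ∈ insert p (nbrs p))
    have h2 := Finset.pred_card_le_card_erase (s := (insert p (nbrs p)).erase q) (a := A)
    rw [card_insert_nbrs (by omega)] at h1
    omega
  obtain ⟨X, hX, hXc⟩ := Finset.exists_subset_card_eq (hcard hqp)
  obtain ⟨Z, hZ, hZc⟩ := Finset.exists_subset_card_eq (hcard hqr')
  have hYc : (((insert q (nbrs q)).erase p).erase r).card = n := by
    rw [Finset.card_erase_of_mem (by simp [hpr.symm, hrq']),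
      Finset.card_erase_of_mem (by simp [hpq']), card_insert_nbrs (by omega)]
    omega
  have hX' : ∀ v ∈ X, (v = p ∨ v ∈ nbrs p) ∧ v ≠ A ∧ v ≠ q ∧ v ≠ r := by
    intro v hv
    have := hX hv
    simp only [Finset.mem_erase, Finset.mem_insert] at this
    refine ⟨this.2.2, this.1, this.2.1, ?_⟩
    rintro rfl
    exact this.2.2.elim hpr.symm hr
  have hY' : ∀ v ∈ ((insert q (nbrs q)).erase p).erase r, (v = q ∨ v ∈ nbrs q) ∧ v ≠ A := by
    intro v hv
    simp only [Finset.mem_erase, Finset.mem_insert] at hv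
    refine ⟨hv.2.2, ?_⟩
    rintro rfl
    exact (hA (by simpa using hv.2.2)).elim hv.2.1 hv.1
  have hZ' : ∀ v ∈ Z, (v = r ∨ v ∈ nbrs r) ∧ v ≠ A ∧ v ≠ p ∧ v ≠ q := by
    intro v hv
    have := hZ hv
    simp only [Finset.mem_erase, Finset.mem_insert] at this
    refine ⟨this.2.2, this.1, ?_, this.2.1⟩
    rintro rfl
    exact this.2.2.elim hpr hp
  -- Every repeated exit lies in `X`: one shared by `Y` and `Z` only would form a triangle with `q`
  -- and `r`.
  obtain ⟨H, hH, hHadj⟩ := isTreeFamily_of_exit_sets hn (by omega) hXc hYc hZc hX' hY' hZ'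
    ((Finset.card_le_card (t := X) (by
      intro v hv
      simp only [Finset.mem_erase, Finset.mem_union, Finset.mem_inter] at hv
      rcases hv with ⟨hvr, hvp, (⟨hv, -⟩ | ⟨hv, -⟩) | ⟨⟨-, -, hvq⟩, hv⟩⟩
      · exact hv
      · exact hv
      · obtain ⟨h4, -, -, hq⟩ := hZ' v hv
        rw [Finset.mem_insert] at hvq
        exact (triangle_free hn hrq' (h4.resolve_left hvr) (hvq.resolve_left hq)).elim)).trans
      hXc.le)
  have hadjq : ∀ {v}, v ∈ nbrs q → v = q ∨ (foldedCube n).Adj q v :=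
    fun h => .inr ((foldedCube_adj_iff_mem_nbrs (by omega)).2 h)
  let P := inCluster A ((foldedCube n).star q p) ⊔ inCluster A ((foldedCube n).star q r)
  have hP : P.verts = {(A, p), (A, q), (A, r)} := by
    ext v
    constructor
    · rintro (⟨h, h' | h'⟩ | ⟨h, h' | h'⟩)
      · exact .inr (.inl (Prod.ext h h'))
      · exact .inl (Prod.ext h h')
      · exact .inr (.inl (Prod.ext h h'))
      · exact .inr (.inr (Prod.ext h h'))
    · rintro (rfl | rfl | rfl)
      · exact .inl ⟨rfl, .inr rfl⟩
      · exact .inl ⟨rfl, .inl rfl⟩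
      · exact .inr ⟨rfl, .inr rfl⟩
  have hPc : P.Connected := sup_inCluster_connected (c := A) (p := q)
    (inCluster_connected (star_connected (hadjq hpq'))) (star_connected (hadjq hrq'))
    ⟨rfl, .inl rfl⟩ (.inl rfl)
  -- No exit of `q` is `p` or `r`, so the other trees have no edge inside `S` and cannot conflict
  -- with the path.
  have hno := hHadj (by
    intro v hv
    simp only [Finset.mem_erase] at hv
    exact ⟨hv.2.1, hv.1⟩)
  refine ⟨Fin.cons P H, ⟨?_, ?_, ?_, ?_⟩⟩
  · exact Fin.cases hPc hH.conn
  · exact Fin.cases hP.ge hH.subset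
  · refine Fin.cases (fun j _ => ?_) (fun i => Fin.cases (fun _ => ?_) fun j hij => ?_)
    · exact Set.inter_subset_left.trans hP.le
    · exact Set.inter_subset_right.trans hP.le
    · exact hH.inter i j fun h => hij (h ▸ rfl)
  · refine Fin.cases (Fin.cases (fun h => absurd rfl h) fun j _ u hu v hv _ => hno j u hu v hv)
      (fun i j _ u hu v hv h => absurd h (hno i u hu v hv))

/-- The case in which `p` and `r` are not adjacent. -/
theorem exists_family_of_not_adj (hn : 3 ≤ n) (A : BinString n) {p q r : BinString n}
    (hpq : p ≠ q) (hpr : p ≠ r) (hqr : q ≠ r) (hr : r ∉ nbrs p) :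
    ∃ H : Fin (n + 1) → (hierarchicalFoldedHypercube n).Subgraph,
      IsTreeFamily _ {(A, p), (A, q), (A, r)} H := by
  -- if `q` and `A` obstruct `p`, then `A` is no exit of `q`
  have key : ∀ {p : BinString n}, q ∈ nbrs p → A ≠ q → A ∈ insert p (nbrs p) →
      A ∈ insert q (nbrs q) → A = p := by
    intro p hq hAq hA hA'
    rw [Finset.mem_insert] at hA hA'
    exact hA.resolve_right fun h => triangle_free hn hq (hA'.resolve_left hAq) h
  by_cases hp' : q ∈ nbrs p → A ≠ q → A ∉ insert p (nbrs p)
  · by_cases hr' : q ∈ nbrs r → A ≠ q → A ∉ insert r (nbrs r)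
    · exact exists_family_of_exits hn hpq hpr hqr hr hp' hr'
    · push Not at hr'
      obtain ⟨hq, hAq, hA⟩ := hr'
      by_cases hqp : q ∈ nbrs p
      · exact exists_family_of_path hn hpq hpr hqr hqp hq fun h => .inr (key hq hAq hA h)
      -- Here `q` is adjacent to `r` only, so `q` and `r` exchange roles: the nonadjacent pair is
      -- now `p`, `q`, and `key` excludes an obstruction at `q`.
      · obtain ⟨H, hH⟩ := exists_family_of_exits hn (A := A) hpr hpq hqr.symm hqp
          (fun h => absurd h hr) (fun _ hAr hA' => hAr (key hq hAq hA hA'))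
        refine ⟨H, ?_⟩
        rwa [Set.pair_comm (A, q)]
  · push Not at hp'
    obtain ⟨hq, hAq, hA⟩ := hp'
    by_cases hqr' : q ∈ nbrs r
    · exact exists_family_of_path hn hpq hpr hqr hq hqr' fun h => .inl (key hq hAq hA h)
    · obtain ⟨H, hH⟩ := exists_family_of_exits hn (A := A) hpq.symm hqr hpr
        (fun h => hqr' (mem_nbrs_comm.1 h)) (fun _ hAp hA' => hAp (key hq hAq hA hA'))
        (fun h => absurd (mem_nbrs_comm.1 h) hr)
      refine ⟨H, ?_⟩
      rwa [Set.insert_comm]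

/-- Folded hypercubes of dimension at least three have no triangles, so some two of the three
vertices are not adjacent; they become the outer pair. -/
theorem exists_family_one_cluster (hn : 3 ≤ n) (A : BinString n) {p q r : BinString n}
    (hpq : p ≠ q) (hpr : p ≠ r) (hqr : q ≠ r) :
    ∃ H : Fin (n + 1) → (hierarchicalFoldedHypercube n).Subgraph,
      IsTreeFamily _ {(A, p), (A, q), (A, r)} H := by
  by_cases hr : r ∈ nbrs p
  · by_cases hq : q ∈ nbrs p
    · have hq' : r ∉ nbrs q := fun h => triangle_free hn hq h hr
      obtain ⟨H, hH⟩ := exists_family_of_not_adj hn A hpq.symm hqr hpr hq'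
      exact ⟨H, by rwa [Set.insert_comm]⟩
    · obtain ⟨H, hH⟩ := exists_family_of_not_adj hn A hpr hpq hqr.symm hq
      exact ⟨H, by rwa [Set.pair_comm]⟩
  · exact exists_family_of_not_adj hn A hpq hpr hqr hr

/-- Three vertices, sorted by cluster. -/
theorem exists_family (hn : 3 ≤ n) {x y z : BinString n × BinString n} (hxy : x ≠ y)
    (hxz : x ≠ z) (hyz : y ≠ z) :
    ∃ H : Fin (n + 1) → (hierarchicalFoldedHypercube n).Subgraph,
      IsTreeFamily _ {x, y, z} H := by
  obtain ⟨A, p⟩ := x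
  obtain ⟨B, q⟩ := y
  obtain ⟨C, r⟩ := z
  by_cases hAB : A = B
  · subst hAB
    have hpq : p ≠ q := fun h => hxy (h ▸ rfl)
    by_cases hAC : A = C
    · subst hAC
      exact exists_family_one_cluster hn A hpq (fun h => hxz (h ▸ rfl)) (fun h => hyz (h ▸ rfl))
    · exact exists_family_two_clusters hn hAC hpq r
  · by_cases hAC : A = C
    · subst hAC
      obtain ⟨H, hH⟩ := exists_family_two_clusters hn hAB (p := p) (q := r)
        (fun h => hxz (h ▸ rfl)) q
      exact ⟨H, by rwa [Set.pair_comm]⟩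
    · by_cases hBC : B = C
      · subst hBC
        obtain ⟨H, hH⟩ := exists_family_two_clusters hn (Ne.symm hAB) (p := q) (q := r)
          (fun h => hyz (h ▸ rfl)) p
        refine ⟨H, ?_⟩
        rwa [Set.insert_comm, Set.pair_comm (A, p)]
      · exact exists_family_three_clusters hn hAB hAC hBC p q r

/-! ### Dimension two, by computation on bit masks -/

section Dimension_two

/-- Closing the set of bits of a number under `f`, for the elements of a list in turn. The match
on the number makes the kernel evaluate it. -/
def bitClosure (f : Fin 16 → ℕ) : List (Fin 16) → ℕ → ℕ
  | [], seen => seen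
  | _ :: _, 0 => 0
  | a :: l, m + 1 => bitClosure f l (if (m + 1).testBit a then (m + 1) ||| f a else m + 1)

theorem reflTransGen_of_bitClosure {f : Fin 16 → ℕ} {i : Fin 16} (l : List (Fin 16)) (seen : ℕ)
    (h : ∀ b : Fin 16, seen.testBit b →
      Relation.ReflTransGen (fun a b : Fin 16 => (f a).testBit b) i b)
    (b : Fin 16) (hb : (bitClosure f l seen).testBit b) :
    Relation.ReflTransGen (fun a b : Fin 16 => (f a).testBit b) i b := by
  induction l generalizing seen with
  | nil => exact h b hb
  | cons a l ih =>
    rcases seen with _ | m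
    · simp [bitClosure] at hb
    refine ih _ (fun c hc => ?_) hb
    by_cases ha : (m + 1).testBit a
    · rw [if_pos ha, Nat.testBit_or, Bool.or_eq_true] at hc
      exact hc.elim (h c) fun hc => (h a ha).tail hc
    · rw [if_neg ha] at hc
      exact h c hc

/-- Numbering of the vertices in dimension two. -/
def vertex (i : Fin 16) : BinString 2 × BinString 2 :=
  (fun j => (i.1 / 4).testBit j, fun j => (i.1 % 4).testBit j)

theorem vertex_injective : Function.Injective vertex := by
  decide +kernel

theorem vertex_bijective : Function.Bijective vertex :=
  (Fintype.bijective_iff_injective_and_card _).2 ⟨vertex_injective, by simp⟩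

/-- The neighbours of a vertex, as bits of a number. -/
def nbrBits (i : Fin 16) : ℕ :=
  [32782, 29, 267, 4103, 226, 1232, 688, 8304, 3588, 3392, 2848, 18176, 57352, 53376,
    47104, 28673].getD i 0

/-- Only this direction matters: an edge missing from the table could make the search fail but not
make a false result pass. -/
theorem adj_of_nbrBits {a b : Fin 16} (h : (nbrBits a).testBit b) :
    (hierarchicalFoldedHypercube 2).Adj (vertex a) (vertex b) := by
  have key : ∀ a b : Fin 16, (nbrBits a).testBit b → vertex a ≠ vertex b ∧
      (((vertex a).1 = (vertex b).1 ∧ hammingDist (vertex a).2 (vertex b).2 = 1) ∨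
       ((vertex a).1 = (vertex b).1 ∧ (vertex a).2 = (vertex b).2.compl) ∨
       ((vertex a).1 ≠ (vertex b).1 ∧ (vertex a).1 = (vertex a).2 ∧ (vertex b).1 = (vertex b).2 ∧
         (vertex b).2 = (vertex a).1.compl) ∨
       ((vertex a).1 ≠ (vertex b).1 ∧ (vertex a).1 ≠ (vertex a).2 ∧ (vertex a).1 = (vertex b).2 ∧
         (vertex a).2 = (vertex b).1)) := by
    decide +kernel
  exact key a b h

/-- The bits of a triple of vertices. -/
def tripleBits (i j k : Fin 16) : ℕ := 2 ^ i.1 ||| 2 ^ j.1 ||| 2 ^ k.1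

theorem testBit_tripleBits {i j k a : Fin 16} :
    (tripleBits i j k).testBit a ↔ a = i ∨ a = j ∨ a = k := by
  simp only [tripleBits, Nat.testBit_or, Nat.testBit_two_pow, Bool.or_eq_true, decide_eq_true_eq,
    or_assoc, Fin.ext_iff, eq_comm (a := (a : ℕ))]

/-- The arcs that a subgraph on the bits `M` may use: edges inside the triple `s` only if `t`. -/
def arcBits (s M : ℕ) (t : Bool) (a : Fin 16) : ℕ :=
  if t || !s.testBit a then nbrBits a &&& M else nbrBits a &&& M &&& (65535 ^^^ s)

theorem testBit_arcBits {s M : ℕ} {t : Bool} {a b : Fin 16} (h : (arcBits s M t a).testBit b) :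
    (nbrBits a).testBit b ∧ M.testBit b ∧ (t = true ∨ ¬ (s.testBit a ∧ s.testBit b)) := by
  unfold arcBits at h
  split_ifs at h with ht
  · rw [Nat.testBit_and, Bool.and_eq_true] at h
    refine ⟨h.1, h.2, ?_⟩
    rw [Bool.or_eq_true] at ht
    exact ht.imp id fun ht h' => by simp [h'.1] at ht
  · rw [Nat.testBit_and, Nat.testBit_and, Bool.and_eq_true, Bool.and_eq_true] at h
    refine ⟨h.1.1, h.1.2, .inr fun h' => ?_⟩
    have h65 : Nat.testBit 65535 b = true :=
      (by decide : ∀ b : Fin 16, Nat.testBit 65535 b = true) b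
    have := h.2
    rw [Nat.testBit_xor, h65, h'.2] at this
    simp at this

/-- An order in which to visit the vertices that suffices for all subgraphs below. -/
def visitOrder : List (Fin 16) :=
  [5, 13, 12, 11, 2, 1, 4, 6, 10, 11, 8, 7, 5, 0, 10, 6, 9, 8, 3, 12, 6, 4, 2, 1, 2, 0, 13, 15,
    3, 14, 4, 12, 11, 14, 8, 10, 5, 7, 12, 10, 13, 6, 4, 11, 9, 15, 6, 14]

/-- The bits `M` can be reached from `i` along the arcs. -/
def spans (i : Fin 16) (s M : ℕ) (t : Bool) : Bool :=
  bitClosure (arcBits s M t) visitOrder (2 ^ i.1) == M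

/-- Some neighbour of `i` in `M` lies outside of the triple `s`: a necessary condition that is
quick to evaluate. -/
def canLeave (i : Fin 16) (s M : ℕ) : Bool := 0 < nbrBits i &&& (M ^^^ s)

/-- A partition of the other vertices that yields three trees for the triple. -/
def isGoodPartition (i j k : Fin 16) (c : ℕ × ℕ × ℕ) : Bool :=
  let s := tripleBits i j k
  -- Only `M₀` may use edges inside the triple, so no such edge is shared. If `c.1` adds nothing,
  -- the first subgraph lives on the triple itself.
  let M₀ := s ||| c.1
  let M₁ := s ||| c.2.1
  let M₂ := s ||| c.2.2
  canLeave i s M₁ && canLeave j s M₁ && canLeave k s M₁ &&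
    canLeave i s M₂ && canLeave j s M₂ && canLeave k s M₂ &&
    (M₀ &&& M₁ == s) && (M₀ &&& M₂ == s) && (M₁ &&& M₂ == s) &&
    spans i s M₁ false && spans i s M₂ false && spans i s M₀ true

/-- Partitions that suffice for all triples. -/
def partitions : List (ℕ × ℕ × ℕ) := [
  (9376, 37151, 19008), (836, 1074, 63625), (4364, 52225, 8946), (32787, 9636, 23112), (12424,
  20324, 32787), (51201, 9970, 4364), (26752, 5420, 33363), (1074, 30856, 33605), (8914, 5420,
  51201), (8384, 52257, 4894), (0, 13260, 52275), (20511, 36672, 8352), (0, 15, 65520), (0, 240,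
  65295), (0, 3840, 61695), (0, 61440, 4095)]

theorem exists_isGoodPartition : ∀ i j k : Fin 16, i < j → j < k →
    (partitions.any (isGoodPartition i j k)) = true := by
  decide +kernel

/-- The subgraph on the bits `M`, with the edges inside the triple `s` only if `t`. -/
def bitSubgraph (s M : ℕ) (t : Bool) : (hierarchicalFoldedHypercube 2).Subgraph where
  verts := {x | ∃ a : Fin 16, vertex a = x ∧ M.testBit a}
  Adj x y := (hierarchicalFoldedHypercube 2).Adj x y ∧ ∃ a b : Fin 16, vertex a = x ∧
    vertex b = y ∧ M.testBit a ∧ M.testBit b ∧ (t = true ∨ ¬ (s.testBit a ∧ s.testBit b))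
  adj_sub h := h.1
  edge_vert := by
    rintro x y ⟨-, a, b, ha, -, hMa, -⟩
    exact ⟨a, ha, hMa⟩
  symm := ⟨by
    rintro x y ⟨h, a, b, ha, hb, hMa, hMb, ht⟩
    exact ⟨h.symm, b, a, hb, ha, hMb, hMa, ht.imp id fun h h' => h h'.symm⟩⟩

theorem bitSubgraph_connected {i : Fin 16} {s M : ℕ} {t : Bool} (hi : M.testBit i)
    (h : spans i s M t = true) : (bitSubgraph s M t).Connected := by
  refine Subgraph.connected_of_root (r := vertex i) ⟨i, rfl, hi⟩ ?_
  rintro _ ⟨b, rfl, hb⟩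
  have hreach : Relation.ReflTransGen (fun a b : Fin 16 => (arcBits s M t a).testBit b) i b := by
    refine reflTransGen_of_bitClosure _ _ ?_ b (by rwa [← beq_iff_eq.1 h] at hb)
    intro b hb
    rw [Nat.testBit_two_pow, decide_eq_true_eq] at hb
    obtain rfl := Fin.ext hb
    exact .refl
  have key : M.testBit b ∧ Relation.ReflTransGen (bitSubgraph s M t).Adj (vertex i) (vertex b) := by
    clear hb
    induction hreach with
    | refl => exact ⟨hi, .refl⟩
    | @tail a b _ hab ih =>
      obtain ⟨h1, h2, h3⟩ := testBit_arcBits hab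
      exact ⟨h2, ih.2.tail ⟨adj_of_nbrBits h1, a, b, rfl, rfl, ih.1, h2, h3⟩⟩
  exact key.2

theorem exists_family_dimension_two_of_lt {i j k : Fin 16} (hij : i < j) (hjk : j < k) :
    ∃ H : Fin 3 → (hierarchicalFoldedHypercube 2).Subgraph,
      IsTreeFamily _ {vertex i, vertex j, vertex k} H := by
  obtain ⟨c, -, hc⟩ := List.any_eq_true.1 (exists_isGoodPartition i j k hij hjk)
  simp only [isGoodPartition, Bool.and_eq_true, beq_iff_eq] at hc
  obtain ⟨⟨⟨⟨⟨⟨-, h01⟩, h02⟩, h12⟩, h1⟩, h2⟩, h0⟩ := hc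
  set s := tripleBits i j k with hs
  let M : Fin 3 → ℕ := ![s ||| c.1, s ||| c.2.1, s ||| c.2.2]
  let t : Fin 3 → Bool := ![true, false, false]
  have hsM : ∀ l, ∀ a : Fin 16, s.testBit a → (M l).testBit a := by
    intro l a ha
    fin_cases l <;> simp [M, Nat.testBit_or, ha]
  have hspan : ∀ l, spans i s (M l) (t l) = true := by
    intro l
    fin_cases l
    · exact h0
    · exact h1
    · exact h2
  have hand : ∀ l l', l ≠ l' → M l &&& M l' = s := by
    intro l l' hl
    fin_cases l <;> fin_cases l'
    · exact absurd rfl hl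
    · exact h01
    · exact h02
    · exact (Nat.and_comm _ _).trans h01
    · exact absurd rfl hl
    · exact h12
    · exact (Nat.and_comm _ _).trans h02
    · exact (Nat.and_comm _ _).trans h12
    · exact absurd rfl hl
  have hS : ∀ a : Fin 16, s.testBit a ↔
      vertex a ∈ ({vertex i, vertex j, vertex k} : Set (BinString 2 × BinString 2)) := by
    intro a
    rw [hs, testBit_tripleBits]
    simp only [Set.mem_insert_iff, Set.mem_singleton_iff, vertex_injective.eq_iff]
  have ht : ∀ l l', l ≠ l' → t l = true → t l' = true → False := by decide
  have hadj : ∀ l, ∀ u ∈ ({vertex i, vertex j, vertex k} : Set (BinString 2 × BinString 2)),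
      ∀ v ∈ ({vertex i, vertex j, vertex k} : Set (BinString 2 × BinString 2)),
      (bitSubgraph s (M l) (t l)).Adj u v → t l = true := by
    rintro l u hu v hv ⟨-, a, b, rfl, rfl, -, -, h⟩
    exact h.resolve_right fun h => h ⟨(hS a).2 hu, (hS b).2 hv⟩
  refine ⟨fun l => bitSubgraph s (M l) (t l), ⟨fun l => bitSubgraph_connected (i := i)
    (hsM l i ((hS i).2 (by simp))) (hspan l), ?_, ?_, ?_⟩⟩
  · intro l x hx
    obtain ⟨a, rfl⟩ := vertex_bijective.2 x
    exact ⟨a, rfl, hsM l a ((hS a).2 hx)⟩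
  · rintro l l' hl _ ⟨⟨a, rfl, ha⟩, b, hb, hb'⟩
    obtain rfl := vertex_injective hb
    rw [← hS, ← hand l l' hl, Nat.testBit_and, ha, hb']
    rfl
  · exact fun l l' hl u hu v hv h h' => ht l l' hl (hadj l u hu v hv h) (hadj l' u hu v hv h')

theorem exists_family_dimension_two {x y z : BinString 2 × BinString 2} (hxy : x ≠ y)
    (hxz : x ≠ z) (hyz : y ≠ z) :
    ∃ H : Fin 3 → (hierarchicalFoldedHypercube 2).Subgraph, IsTreeFamily _ {x, y, z} H := by
  obtain ⟨i, rfl⟩ := vertex_bijective.2 x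
  obtain ⟨j, rfl⟩ := vertex_bijective.2 y
  obtain ⟨k, rfl⟩ := vertex_bijective.2 z
  have hij : i ≠ j := fun h => hxy (h ▸ rfl)
  have hik : i ≠ k := fun h => hxz (h ▸ rfl)
  have hjk : j ≠ k := fun h => hyz (h ▸ rfl)
  rcases hij.lt_or_gt with h1 | h1 <;> rcases hjk.lt_or_gt with h2 | h2
  · exact exists_family_dimension_two_of_lt h1 h2
  · rcases hik.lt_or_gt with h3 | h3
    · rw [Set.pair_comm]
      exact exists_family_dimension_two_of_lt h3 h2
    · rw [Set.pair_comm, Set.insert_comm]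
      exact exists_family_dimension_two_of_lt h3 h1
  · rcases hik.lt_or_gt with h3 | h3
    · rw [Set.insert_comm]
      exact exists_family_dimension_two_of_lt h1 h3
    · rw [Set.insert_comm, Set.pair_comm]
      exact exists_family_dimension_two_of_lt h2 h3
  · rw [Set.insert_comm, Set.pair_comm, Set.insert_comm]
    exact exists_family_dimension_two_of_lt h2 h1

end Dimension_two

/-! ### Degrees and the final theorem -/

/-- The vertices adjacent to `x`: those of its cluster, and the one in another cluster. -/
def neighbors (x : BinString n × BinString n) : Finset (BinString n × BinString n) :=
  insert (if x.1 = x.2 then (x.1.compl, x.1.compl) else (x.2, x.1))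
    ((nbrs x.2).image fun p => (x.1, p))

theorem mem_neighbors {x y : BinString n × BinString n}
    (h : (hierarchicalFoldedHypercube n).Adj x y) : y ∈ neighbors x := by
  obtain ⟨c, p⟩ := x
  obtain ⟨d, q⟩ := y
  obtain ⟨-, ⟨rfl, h⟩ | ⟨rfl, h⟩ | ⟨-, hcp, hdq, h⟩ | ⟨-, hcp, hcq, hpd⟩⟩ := h
  · obtain ⟨i, hi⟩ := hammingDist_eq_one_iff.1 h
    exact Finset.mem_insert_of_mem (Finset.mem_image.2 ⟨q, mem_nbrs.2 ⟨_, hi⟩, rfl⟩)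
  · refine Finset.mem_insert_of_mem (Finset.mem_image.2 ⟨q, mem_nbrs_comm.1 (mem_nbrs.2 ?_), rfl⟩)
    exact ⟨none, by rw [← compl_eq_symmDiff]; exact h⟩
  · refine Finset.mem_insert.2 (.inl ?_)
    rw [if_pos hcp]
    exact Prod.ext (hdq.trans h) h
  · refine Finset.mem_insert.2 (.inl ?_)
    rw [if_neg hcp]
    exact Prod.ext hpd.symm hcq.symm

theorem card_neighbors_le (hn : 2 ≤ n) (x : BinString n × BinString n) :
    (neighbors x).card ≤ n + 2 := by
  refine (Finset.card_insert_le _ _).trans (Nat.add_le_add_right ?_ 1)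
  exact Finset.card_image_le.trans (card_nbrs hn _).le

end HFQ

open HFQ BinString SimpleGraph in
theorem corollary4p3 (n : ℕ) (hn : 2 ≤ n) :
    (hierarchicalFoldedHypercube n).generalizedConnectivity 3 = ((n + 1 : ℕ) : ℕ∞) := by
  apply le_antisymm
  -- The degree argument works for any adjacent pair and any third vertex; here `x` and `y` are
  -- complementary positions of one cluster.
  · let x : BinString n × BinString n := (⊥, ⊥)
    let y : BinString n × BinString n := (⊥, gen none)
    let z : BinString n × BinString n := (gen none, ⊥)
    have hne : gen none ≠ (⊥ : BinString n) := gen_ne_bot (by omega) none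
    have hxy : x ≠ y := fun h => hne (Prod.ext_iff.1 h).2.symm
    have hzx : z ≠ x := fun h => hne (Prod.ext_iff.1 h).1
    have hzy : z ≠ y := fun h => hne (Prod.ext_iff.1 h).1
    have hadj : (hierarchicalFoldedHypercube n).Adj x y :=
      adj_of_foldedCube ⟨hne.symm, none, by simp⟩
    refine iInf₂_le_of_le {x, y, z} (Finset.card_eq_three.2 ⟨x, y, z, hxy, hzx.symm, hzy.symm, rfl⟩)
      (iSup₂_le fun r hr => ?_)
    obtain ⟨T, hT⟩ := hr
    have := lt_of_internallyEdgeDisjointSTrees hT (x := x) (y := y) (z := z) (by simp) (by simp)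
      (by simp) hadj hzx hzy (fun _ => mem_neighbors) (fun _ => mem_neighbors)
      (card_neighbors_le hn x) (card_neighbors_le hn y)
    exact_mod_cast Nat.lt_succ_iff.1 this
  · refine le_iInf₂ fun S hS => ?_
    obtain ⟨x, y, z, hxy, hxz, hyz, rfl⟩ := Finset.card_eq_three.1 hS
    obtain ⟨H, hH⟩ : ∃ H : Fin (n + 1) → (hierarchicalFoldedHypercube n).Subgraph,
        IsTreeFamily _ {x, y, z} H := by
      rcases hn.eq_or_lt with rfl | hn
      · exact exists_family_dimension_two hxy hxz hyz
      · exact exists_family hn hxy hxz hyz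
    refine le_iSup₂_of_le (n + 1) ?_ le_rfl
    rw [Finset.coe_insert, Finset.coe_pair]
    exact exists_internallyEdgeDisjointSTrees H hH.conn hH.subset hH.inter hH.adj
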